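/- **Conventions.** An edge-weighted graph $(G,l)$ is a finite connected nonempty multigraph (loops allowed) with $l:E(G)\to\mathbb R_{>0}\cup\{\infty\}$, where $l(e)=\infty$ is allowed only for edges $e$ incident to a vertex of valence one. A *tropical curve* $\Gamma$ is the space obtained from such a $(G,l)$ by identifying each edge $e$ with $[0,l(e)]$ (where $[0,\infty]$ is the one-point compactification of $[0,\infty)$, and $\infty$ is placed at an end of valence one), with the path distance $\operatorname{dist}$; $(G,l)$ is then called a model of $\Gamma$, and it is loopless if $G$ has no loops. $\Gamma_\infty$ is the set of points identified with $\infty$ (points at infinity); the other points are finite. $\boldsymbol T=(\mathbb R\cup\{-\infty\},\max,+)$ is the tropical semifield. A *rational function* on $\Gamma$ is a continuous map $f:\Gamma\to\mathbb R\cup\{\pm\infty\}$ which is either constantly $-\infty$, or piecewise affine with integer slopes and finitely many pieces and takes the values $\pm\infty$ at most at points at infinity. The set $\operatorname{Rat}(\Gamma)$ of these functions is a semifield under $f\oplus g=\max(f,g)$ and $f\odot g=f+g$ (computed at finite points and extended continuously to $\Gamma_\infty$), and a $\boldsymbol T$-algebra through the constant functions. For $S\subset\Gamma$ and $l\in(0,\infty]$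 put $\operatorname{CF}(S;l)(x)=-\min(l,\operatorname{dist}(x,S))$. For $r>0$, a map $\varphi:\Gamma_1\to\Gamma_2$ is *$r$-expansive* if it is a continuous bijection, maps $\Gamma_1\setminus\Gamma_{1\infty}$ bijectively onto $\Gamma_2\setminus\Gamma_{2\infty}$, and $\operatorname{dist}(\varphi(x),\varphi(y))=r\cdot\operatorname{dist}(x,y)$ for all finite $x,y$. A continuous map $\varphi:\Gamma_1\to\Gamma_2$ is a *finite harmonic morphism of degree $d$* if there are loopless models $(G_1,l_1),(G_2,l_2)$ of $\Gamma_1,\Gamma_2$ such that $\varphi$ maps vertices of $G_1$ to vertices of $G_2$ and edges onto edges; for each $e\in E(G_1)$ there is a positive integer $\deg_e(\varphi)$ with $\operatorname{dist}(\varphi(x),\varphi(y))=\deg_e(\varphi)\operatorname{dist}(x,y)$ for all $x,y\in e$; for each $v\in V(G_1)$ the sum $\deg_v(\varphi)=\sum_{e\ni v,\,e\mapsto e'}\deg_e(\varphi)$ is the same for all edges $e'$ of $G_2$ incident to $\varphi(v)$; and $\sum_{v\mapsto v'}\deg_v(\varphi)=d$ for every $v'\in V(G_2)$. A map between one-point curves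 has every positive integer as a degree. **Theorem.** Let $\Gamma_1,\Gamma_2$ be tropical curves and $\psi:\operatorname{Rat}(\Gamma_1)\to\operatorname{Rat}(\Gamma_2)$ a semiring isomorphism. Then $\psi$ maps the constant function $1$ to a constant function $r=\psi(1)\in\mathbb R_{>0}$, and $\psi$ induces an $r$-expansive map $\varphi:\Gamma_1\to\Gamma_2$. Here "induces" means that $\varphi$ is the unique map $\Gamma_1\to\Gamma_2$ such that 1. for every finite point $x$, $\varphi(x)$ is a finite point and $\psi(\operatorname{CF}(\{x\};\varepsilon))=\operatorname{CF}(\{\varphi(x)\};r\varepsilon)$ for some real $\varepsilon>0$; 2. for every $x\in\Gamma_{1\infty}$, $\varphi(x)\in\Gamma_{2\infty}$, and there is a finite point $y$ on the edge of infinite length at $x$ such that $\varphi(y)$ is on the edge of infinite length at $\varphi(x)$ and $\psi(\operatorname{CF}(\Gamma_1\setminus(y,x];\infty))=\operatorname{CF}(\Gamma_2\setminus(\varphi(y),\varphi(x)];\infty)$; and $\varphi$ satisfies $\psi(f)(\varphi(x))=r\cdot f(x)$ for all $f\in\operatorname{Rat}(\Gamma_1)$ and $x\in\Gamma_1$ (with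 $r\cdot(\pm\infty)=\pm\infty$). In particular, if $\psi$ is a $\boldsymbol T$-algebra isomorphism, then $r=1$ and $\varphi$ is a finite harmonic morphism of degree one. -/

import Mathlib

open scoped ENNReal Topology

/-- An edge-weighted graph: a finite, connected, nonempty multigraph (loops allowed) with a length
in `(0, ∞]` on every edge. The orientation only serves to identify the edge `e` with the interval
`[0, len e]`, its `src` being `0` and its `tgt` being `len e`. An edge of infinite length is a leaf
edge, identified with `[0, ∞]` in such a way that `∞` is a leaf end. -/
structure EdgeWeightedGraph where
  V : Type
  E : Type
  [fintypeV : Fintype V]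
  [fintypeE : Fintype E]
  [nonemptyV : Nonempty V]
  src : E → V
  tgt : E → V
  len : E → ℝ≥0∞
  len_pos : ∀ e, 0 < len e
  connected : ∀ v w, Relation.EqvGen (fun a b => ∃ e, src e = a ∧ tgt e = b) v w
  /-- The end at infinity has valence one (a loop would count twice). -/
  leaf : ∀ e, len e = ⊤ →
    Nat.card {e' // src e' = tgt e} + Nat.card {e' // tgt e' = tgt e} = 1

attribute [instance] EdgeWeightedGraph.fintypeV EdgeWeightedGraph.fintypeE
  EdgeWeightedGraph.nonemptyV

/-- The tropical semifield `ℝ ∪ {-∞}` with `max` as addition and `+` as multiplication. (Mathlib's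
`Tropical` takes minima, hence the order dual; the `⊤` of `WithTop ℝᵒᵈ` is `-∞`.) -/
abbrev TropicalReal : Type := Tropical (WithTop ℝᵒᵈ)

namespace TropicalReal

/-- A real number as an element of the tropical semifield. -/
def ofReal (a : ℝ) : TropicalReal := Tropical.trop ((OrderDual.toDual a : ℝᵒᵈ) : WithTop ℝᵒᵈ)

/-- The inclusion of `ℝ ∪ {-∞}` into the extended reals. -/
noncomputable def toEReal (t : TropicalReal) : EReal :=
  WithTop.recTopCoe (C := fun _ => EReal) ⊥
    (fun a : ℝᵒᵈ => ((OrderDual.ofDual a : ℝ) : EReal)) (Tropical.untrop t)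

theorem toEReal_zero : toEReal 0 = ⊥ := rfl

theorem toEReal_one : toEReal 1 = 0 := rfl

theorem toEReal_ofReal (a : ℝ) : toEReal (ofReal a) = (a : EReal) := rfl

theorem toEReal_cases (t : TropicalReal) : t = 0 ∨ ∃ a : ℝ, t = ofReal a := by
  induction t using Tropical.tropRec with
  | _ X =>
    induction X using WithTop.recTopCoe with
    | top => exact Or.inl rfl
    | coe a => exact Or.inr ⟨OrderDual.ofDual a, rfl⟩

theorem ofReal_add (a b : ℝ) : ofReal a + ofReal b = ofReal (max a b) := by
  apply Tropical.untrop_injective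
  rw [Tropical.untrop_add]
  exact (WithTop.coe_min _ _).symm

theorem ofReal_mul (a b : ℝ) : ofReal a * ofReal b = ofReal (a + b) := rfl

theorem toEReal_add (s t : TropicalReal) : toEReal (s + t) = max (toEReal s) (toEReal t) := by
  rcases toEReal_cases s with rfl | ⟨a, rfl⟩
  · simp [toEReal_zero]
  rcases toEReal_cases t with rfl | ⟨b, rfl⟩
  · simp [toEReal_zero]
  rw [ofReal_add]
  simp only [toEReal_ofReal]
  exact EReal.coe_strictMono.monotone.map_max

theorem toEReal_mul (s t : TropicalReal) : toEReal (s * t) = toEReal s + toEReal t := by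
  rcases toEReal_cases s with rfl | ⟨a, rfl⟩
  · simp [toEReal_zero]
  rcases toEReal_cases t with rfl | ⟨b, rfl⟩
  · simp [toEReal_zero]
  rw [ofReal_mul]
  simp only [toEReal_ofReal]
  exact EReal.coe_add a b

end TropicalReal

/-- `u` is piecewise affine on `D` with integer slopes and finitely many pieces: `D` is covered by
finitely many intervals, on each of which `u` is affine with integer slope. -/
def IsPiecewiseAffineOn (u : ℝ → EReal) (D : Set ℝ) : Prop :=
  ∃ P : Set (Set ℝ), P.Finite ∧ D ⊆ ⋃₀ P ∧ ∀ I ∈ P, I.OrdConnected ∧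
    ∃ (a : ℤ) (b : ℝ), ∀ t ∈ I ∩ D, u t = ((a * t + b : ℝ) : EReal)

namespace IsPiecewiseAffineOn

variable {u v w : ℝ → EReal} {D : Set ℝ}

theorem const (c : ℝ) : IsPiecewiseAffineOn (fun _ => (c : EReal)) D :=
  ⟨{Set.univ}, Set.finite_singleton _, by simp, by
    rintro I rfl
    exact ⟨Set.ordConnected_univ, 0, c, by simp⟩⟩

theorem add (hu : IsPiecewiseAffineOn u D) (hv : IsPiecewiseAffineOn v D)
    (hw : ∀ t ∈ D, w t = u t + v t) : IsPiecewiseAffineOn w D := by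
  obtain ⟨P, hP, hPD, hPa⟩ := hu
  obtain ⟨Q, hQ, hQD, hQa⟩ := hv
  refine ⟨Set.image2 (· ∩ ·) P Q, hP.image2 _ hQ, ?_, ?_⟩
  · intro t ht
    obtain ⟨I, hI, htI⟩ := hPD ht
    obtain ⟨J, hJ, htJ⟩ := hQD ht
    exact ⟨I ∩ J, ⟨I, hI, J, hJ, rfl⟩, htI, htJ⟩
  · rintro _ ⟨I, hI, J, hJ, rfl⟩
    obtain ⟨hIo, a, b, hab⟩ := hPa I hI
    obtain ⟨hJo, a', b', hab'⟩ := hQa J hJ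
    refine ⟨hIo.inter hJo, a + a', b + b', ?_⟩
    rintro t ⟨⟨htI, htJ⟩, htD⟩
    rw [hw t htD, hab t ⟨htI, htD⟩, hab' t ⟨htJ, htD⟩, ← EReal.coe_add]
    congr 1
    push_cast
    ring

theorem ordConnected_affine (a b : ℝ) : {t : ℝ | 0 ≤ a * t + b}.OrdConnected := by
  refine ⟨fun x hx y hy z hz => ?_⟩
  simp only [Set.mem_ofPred_eq, Set.mem_Icc] at *
  rcases le_total 0 a with h | h
  · nlinarith
  · nlinarith

theorem max (hu : IsPiecewiseAffineOn u D) (hv : IsPiecewiseAffineOn v D) :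
    IsPiecewiseAffineOn (fun t => max (u t) (v t)) D := by
  obtain ⟨P, hP, hPD, hPa⟩ := hu
  obtain ⟨Q, hQ, hQD, hQa⟩ := hv
  choose! hPo a b hab using hPa
  choose! hQo a' b' hab' using hQa
  have key : ∀ I ∈ P, ∀ J ∈ Q, ∀ t ∈ I ∩ J ∩ D, Max.max (u t) (v t) =
      ((Max.max (a I * t + b I) (a' J * t + b' J) : ℝ) : EReal) := by
    rintro I hI J hJ t ⟨⟨htI, htJ⟩, htD⟩
    rw [hab I hI t ⟨htI, htD⟩, hab' J hJ t ⟨htJ, htD⟩]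
    exact (EReal.coe_strictMono.monotone.map_max).symm
  refine ⟨Set.image2 (fun I J => I ∩ J ∩ {t | 0 ≤ ((a I - a' J : ℤ) : ℝ) * t + (b I - b' J)}) P Q ∪
    Set.image2 (fun I J => I ∩ J ∩ {t | 0 ≤ ((a' J - a I : ℤ) : ℝ) * t + (b' J - b I)}) P Q,
    (hP.image2 _ hQ).union (hP.image2 _ hQ), ?_, ?_⟩
  · intro t ht
    obtain ⟨I, hI, htI⟩ := hPD ht
    obtain ⟨J, hJ, htJ⟩ := hQD ht
    rcases le_total (a' J * t + b' J) (a I * t + b I) with h | h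
    · refine ⟨_, Or.inl ⟨I, hI, J, hJ, rfl⟩, ⟨htI, htJ⟩, ?_⟩
      simp only [Set.mem_ofPred_eq]
      push_cast
      linarith
    · refine ⟨_, Or.inr ⟨I, hI, J, hJ, rfl⟩, ⟨htI, htJ⟩, ?_⟩
      simp only [Set.mem_ofPred_eq]
      push_cast
      linarith
  · rintro _ (⟨I, hI, J, hJ, rfl⟩ | ⟨I, hI, J, hJ, rfl⟩)
    · refine ⟨((hPo I hI).inter (hQo J hJ)).inter (ordConnected_affine _ _), a I, b I, ?_⟩
      rintro t ⟨⟨htIJ, ht⟩, htD⟩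
      refine (key I hI J hJ t ⟨htIJ, htD⟩).trans ?_
      rw [max_eq_left]
      simp only [Set.mem_ofPred_eq] at ht
      push_cast at ht
      linarith
    · refine ⟨((hPo I hI).inter (hQo J hJ)).inter (ordConnected_affine _ _), a' J, b' J, ?_⟩
      rintro t ⟨⟨htIJ, ht⟩, htD⟩
      refine (key I hI J hJ t ⟨htIJ, htD⟩).trans ?_
      rw [max_eq_right]
      simp only [Set.mem_ofPred_eq] at ht
      push_cast at ht
      linarith

theorem eventually_affine (hu : IsPiecewiseAffineOn u D) (hD : Set.Ici 0 ⊆ D) :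
    ∃ (a : ℤ) (b : ℝ), ∀ᶠ t in Filter.atTop, u t = ((a * t + b : ℝ) : EReal) := by
  obtain ⟨P, hP, hPD, hPa⟩ := hu
  have h : ∃ I ∈ P, ∃ᶠ t in Filter.atTop, t ∈ I := by
    by_contra hcon
    simp only [not_exists, not_and, Filter.not_frequently] at hcon
    have h1 := (Filter.eventually_all_finite hP).2 hcon
    obtain ⟨t, ht, ht0⟩ := (h1.and (Filter.eventually_ge_atTop (0 : ℝ))).exists
    obtain ⟨I, hI, htI⟩ := hPD (hD ht0)
    exact ht I hI htI
  obtain ⟨I, hI, hfr⟩ := h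
  obtain ⟨hIo, a, b, hab⟩ := hPa I hI
  refine ⟨a, b, ?_⟩
  obtain ⟨t₀, ht₀⟩ := hfr.exists
  filter_upwards [Filter.eventually_ge_atTop t₀, Filter.eventually_ge_atTop 0] with t h1 h2
  obtain ⟨s, hs, hsI⟩ := (Filter.frequently_atTop.1 hfr) t
  exact hab t ⟨hIo.out ht₀ hsI ⟨h1, hs⟩, hD h2⟩

theorem exists_tendsto (hu : IsPiecewiseAffineOn u D) (hD : Set.Ici 0 ⊆ D) :
    ∃ L : EReal, Filter.Tendsto u Filter.atTop (𝓝 L) := by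
  obtain ⟨a, b, hab⟩ := hu.eventually_affine hD
  suffices ∃ L : EReal,
      Filter.Tendsto (fun t : ℝ => ((a * t + b : ℝ) : EReal)) Filter.atTop (𝓝 L) by
    obtain ⟨L, hL⟩ := this
    exact ⟨L, hL.congr' (hab.mono fun t ht => ht.symm)⟩
  rcases lt_trichotomy a 0 with h | h | h
  · refine ⟨⊥, EReal.tendsto_coe_nhds_bot_iff.2 ?_⟩
    have : (a : ℝ) < 0 := by exact_mod_cast h
    exact Filter.tendsto_atBot_add_const_right _ _
      (Filter.tendsto_id.const_mul_atTop_of_neg this)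
  · subst h
    exact ⟨(b : EReal), by simp⟩
  · refine ⟨⊤, EReal.tendsto_coe_nhds_top_iff.2 ?_⟩
    have : (0 : ℝ) < a := by exact_mod_cast h
    exact Filter.tendsto_atTop_add_const_right _ _
      (Filter.tendsto_id.const_mul_atTop this)

end IsPiecewiseAffineOn

namespace EdgeWeightedGraph

variable (G : EdgeWeightedGraph)

/-- The points of the tropical curve given by `G`: the vertices of `G`, and the points with
parameter `t` in the open interval `(0, len e)` for the edges `e` of `G`. -/
inductive Point : Type
  | vertex (v : G.V)
  | inner (e : G.E) (t : ℝ≥0∞) (pos : 0 < t) (lt : t < G.len e)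

open Classical in
/-- The point with parameter `t` on the edge `e`; only parameters `t ∈ [0, len e]` matter. -/
noncomputable def edge (e : G.E) (t : ℝ≥0∞) : G.Point :=
  if h : 0 < t ∧ t < G.len e then .inner e t h.1 h.2
  else if t = 0 then .vertex (G.src e) else .vertex (G.tgt e)

/-- The topology of the tropical curve: the quotient topology for the identification of the
endpoints of the closed intervals `[0, len e] ⊆ [0, ∞]` with the vertices. -/
noncomputable instance : TopologicalSpace G.Point :=
  ⨆ e : G.E, TopologicalSpace.coinduced
    (fun t : Set.Icc (0 : ℝ≥0∞) (G.len e) => G.edge e t) inferInstance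

/-- There is a path of length `ℓ` from `x` to `y` composed of finitely many segments of edges. -/
inductive IsPath (x : G.Point) : G.Point → ℝ≥0∞ → Prop
  | nil : IsPath x x 0
  | snoc {y z : G.Point} {ℓ : ℝ≥0∞} (e : G.E) (s t : ℝ≥0∞) (hs : s ≤ G.len e) (ht : t ≤ G.len e)
      (hy : G.edge e s = y) (hz : G.edge e t = z) (h : IsPath x y ℓ) :
      IsPath x z (ℓ + ((s - t) + (t - s)))

/-- The distance of two points: the infimum of the lengths of the paths between them. -/
noncomputable def dist (x y : G.Point) : ℝ≥0∞ := sInf {ℓ | G.IsPath x y ℓ}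

/-- The set of points at infinity. -/
def infinitePoints : Set G.Point := {x | ∃ e, G.len e = ⊤ ∧ x = G.edge e ⊤}

/-- The set of finite points. -/
def finitePoints : Set G.Point := G.infinitePointsᶜ

/-- A rational function: a continuous function to `ℝ ∪ {±∞}` that is either constantly `-∞`, or
piecewise affine with integer slopes and finitely many pieces, and with values `±∞` at most at the
points at infinity. -/
def IsRational (f : G.Point → EReal) : Prop :=
  Continuous f ∧ ((∀ x, f x = ⊥) ∨
    ((∀ x ∈ G.finitePoints, f x ≠ ⊥ ∧ f x ≠ ⊤) ∧
      ∀ e, IsPiecewiseAffineOn (fun t => f (G.edge e (ENNReal.ofReal t)))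
        {t | 0 ≤ t ∧ ENNReal.ofReal t ≤ G.len e}))

/-- The set of rational functions on the tropical curve given by `G`. -/
def Rat : Type := {f : G.Point → EReal // G.IsRational f}

variable {G}

instance : CoeFun G.Rat (fun _ => G.Point → EReal) := ⟨Subtype.val⟩

theorem edge_zero (e : G.E) : G.edge e 0 = .vertex (G.src e) := by simp [edge]

theorem edge_len (e : G.E) : G.edge e (G.len e) = .vertex (G.tgt e) := by
  simp [edge, (G.len_pos e).ne']

theorem edge_inner (e : G.E) (t : ℝ≥0∞) (h0 : 0 < t) (h1 : t < G.len e) :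
    G.edge e t = .inner e t h0 h1 := by simp [edge, h0, h1]

theorem edge_top {e : G.E} (he : G.len e = ⊤) : G.edge e ⊤ = .vertex (G.tgt e) := by
  rw [← he, edge_len]

theorem src_ne_of_len_eq_top {e : G.E} (he : G.len e = ⊤) (e' : G.E) : G.src e' ≠ G.tgt e := by
  intro h
  have h1 : 0 < Nat.card {e' // G.src e' = G.tgt e} :=
    Nat.card_pos_iff.2 ⟨⟨⟨e', h⟩⟩, inferInstance⟩
  have h2 : 0 < Nat.card {e' // G.tgt e' = G.tgt e} :=
    Nat.card_pos_iff.2 ⟨⟨⟨e, rfl⟩⟩, inferInstance⟩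
  have := G.leaf e he
  omega

theorem eq_of_tgt_eq {e : G.E} (he : G.len e = ⊤) {e' : G.E} (h : G.tgt e' = G.tgt e) :
    e' = e := by
  have h3 : Nat.card {e' // G.tgt e' = G.tgt e} ≤ 1 := by
    have := G.leaf e he
    omega
  have := (Finite.card_le_one_iff_subsingleton).1 h3
  exact congrArg Subtype.val (Subsingleton.elim (⟨e', h⟩ : {e' // G.tgt e' = G.tgt e}) ⟨e, rfl⟩)

theorem edge_mem_finitePoints {e : G.E} {t : ℝ≥0∞} (ht : t ≤ G.len e) (ht' : t ≠ ⊤) :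
    G.edge e t ∈ G.finitePoints := by
  rintro ⟨e', he', h⟩
  rw [edge_top he'] at h
  rcases eq_or_ne t 0 with rfl | h0
  · rw [edge_zero] at h
    exact src_ne_of_len_eq_top he' e (Point.vertex.inj h)
  rcases ht.lt_or_eq with h1 | rfl
  · rw [edge_inner e t (pos_iff_ne_zero.2 h0) h1] at h
    cases h
  · rw [edge_len] at h
    have := eq_of_tgt_eq he' (Point.vertex.inj h)
    exact ht' (this ▸ he')

theorem continuous_edge (e : G.E) :
    Continuous (fun t : Set.Icc (0 : ℝ≥0∞) (G.len e) => G.edge e t) :=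
  continuous_iff_coinduced_le.2
    (le_iSup (fun e : G.E => TopologicalSpace.coinduced
      (fun t : Set.Icc (0 : ℝ≥0∞) (G.len e) => G.edge e t) inferInstance) e)

theorem continuousOn_edge (e : G.E) : ContinuousOn (G.edge e) (Set.Icc 0 (G.len e)) :=
  continuousOn_iff_continuous_domRestrict.2 (continuous_edge e)

theorem continuous_iff {f : G.Point → EReal} :
    Continuous f ↔ ∀ e, ContinuousOn (fun t => f (G.edge e t)) (Set.Icc 0 (G.len e)) := by
  refine ⟨fun h e => h.comp_continuousOn (continuousOn_edge e), fun h => ?_⟩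
  refine continuous_iSup_dom.2 fun e => continuous_coinduced_dom.2 ?_
  exact continuousOn_iff_continuous_domRestrict.1 (h e)

theorem isRational_const (t : TropicalReal) : G.IsRational (fun _ => t.toEReal) := by
  refine ⟨continuous_const, ?_⟩
  rcases TropicalReal.toEReal_cases t with rfl | ⟨a, rfl⟩
  · exact Or.inl fun _ => rfl
  · exact Or.inr ⟨fun _ _ => ⟨EReal.coe_ne_bot a, EReal.coe_ne_top a⟩,
      fun _ => IsPiecewiseAffineOn.const a⟩

theorem isRational_max {f g : G.Point → EReal} (hf : G.IsRational f) (hg : G.IsRational g) :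
    G.IsRational (fun x => max (f x) (g x)) := by
  refine ⟨hf.1.max hg.1, ?_⟩
  rcases hf.2 with hf' | ⟨hf', hf''⟩
  · simpa [hf'] using hg.2
  rcases hg.2 with hg' | ⟨hg', hg''⟩
  · simpa [hg'] using Or.inr ⟨hf', hf''⟩
  refine Or.inr ⟨fun x hx => ?_, fun e => (hf'' e).max (hg'' e)⟩
  change max (f x) (g x) ≠ ⊥ ∧ max (f x) (g x) ≠ ⊤
  rcases max_choice (f x) (g x) with h | h <;> rw [h]
  · exact hf' x hx
  · exact hg' x hx

/-- Two rational functions that agree at the finite points are equal. -/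
theorem Rat.ext_finite {f g : G.Rat} (h : ∀ x ∈ G.finitePoints, f x = g x) : f = g := by
  refine Subtype.ext (funext fun x => ?_)
  by_cases hx : x ∈ G.finitePoints
  · exact h x hx
  obtain ⟨e, he, rfl⟩ := not_not.1 hx
  have hIcc : Set.Icc (0 : ℝ≥0∞) (G.len e) = Set.univ := by rw [he]; ext; simp
  have hcf := continuous_iff.1 f.2.1 e
  have hcg := continuous_iff.1 g.2.1 e
  rw [hIcc, continuousOn_univ] at hcf hcg
  have : Set.EqOn (fun t => f.1 (G.edge e t)) (fun t => g.1 (G.edge e t)) {⊤}ᶜ :=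
    fun t ht => h _ (edge_mem_finitePoints (he ▸ le_top) ht)
  exact congrFun (hcf.ext_on (dense_compl_singleton ⊤) hcg this) ⊤

theorem exists_tendsto_top {e : G.E} (he : G.len e = ⊤) {F : G.Point → ℝ}
    (hF : IsPiecewiseAffineOn (fun t => (F (G.edge e (ENNReal.ofReal t)) : EReal))
      {t | 0 ≤ t ∧ ENNReal.ofReal t ≤ G.len e}) :
    ∃ L : EReal, Filter.Tendsto (fun t => (F (G.edge e t) : EReal)) (𝓝[≠] ⊤) (𝓝 L) := by
  obtain ⟨L, hL⟩ := hF.exists_tendsto (fun t ht => ⟨ht, he ▸ le_top⟩)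
  refine ⟨L, ?_⟩
  have h1 : Filter.Tendsto ENNReal.toReal (𝓝[≠] ⊤) Filter.atTop := by
    refine Filter.tendsto_atTop.2 fun b => ?_
    have : ∀ᶠ t : ℝ≥0∞ in 𝓝[≠] ⊤, ENNReal.ofReal b < t :=
      nhdsWithin_le_nhds (lt_mem_nhds ENNReal.ofReal_lt_top)
    filter_upwards [this, self_mem_nhdsWithin] with t ht ht'
    exact (ENNReal.ofReal_le_iff_le_toReal ht').1 ht.le
  refine (hL.comp h1).congr' ?_
  filter_upwards [self_mem_nhdsWithin] with t ht
  simp only [Function.comp_apply]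
  rw [ENNReal.ofReal_toReal ht]

open Classical in
/-- A continuous piecewise affine function on the finite points extends to a rational function. -/
theorem exists_isRational {F : G.Point → ℝ}
    (hc : ∀ e, ContinuousOn (fun t => F (G.edge e t)) {t | t ≤ G.len e ∧ t ≠ ⊤})
    (hF : ∀ e, IsPiecewiseAffineOn (fun t => (F (G.edge e (ENNReal.ofReal t)) : EReal))
      {t | 0 ≤ t ∧ ENNReal.ofReal t ≤ G.len e}) :
    ∃ h : G.Point → EReal, G.IsRational h ∧ ∀ x ∈ G.finitePoints, h x = F x := by
  choose! L hL using fun (e : G.E) (he : G.len e = ⊤) => exists_tendsto_top he (hF e)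
  let h : G.Point → EReal := fun x =>
    if hx : x ∈ G.infinitePoints then L hx.choose else (F x : EReal)
  have hfin : ∀ x ∈ G.finitePoints, h x = F x := fun x hx => dif_neg hx
  have htop : ∀ e, G.len e = ⊤ → h (G.edge e ⊤) = L e := by
    intro e he
    have hx : G.edge e ⊤ ∈ G.infinitePoints := ⟨e, he, rfl⟩
    have h1 : h (G.edge e ⊤) = L hx.choose := dif_pos hx
    have h2 := hx.choose_spec
    have h3 := (edge_top he).symm.trans (h2.2.trans (edge_top h2.1))
    rw [h1, eq_of_tgt_eq he (Point.vertex.inj h3).symm]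
  refine ⟨h, ⟨continuous_iff.2 fun e t ht => ?_, Or.inr ⟨fun x hx => ?_, fun e => ?_⟩⟩, hfin⟩
  · rcases eq_or_ne t ⊤ with rfl | htt
    · have he : G.len e = ⊤ := top_le_iff.1 ht.2
      have hIcc : Set.Icc (0 : ℝ≥0∞) (G.len e) = Set.univ := by rw [he]; ext; simp
      rw [hIcc, continuousWithinAt_univ, continuousAt_iff_punctured_nhds, htop e he]
      refine (hL e he).congr' ?_
      filter_upwards [self_mem_nhdsWithin] with s hs
      exact (hfin _ (edge_mem_finitePoints (he ▸ le_top) hs)).symm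
    · have h1 : ContinuousWithinAt (fun t => (F (G.edge e t) : EReal))
          {t | t ≤ G.len e ∧ t ≠ ⊤} t :=
        continuous_coe_real_ereal.continuousAt.comp_continuousWithinAt (hc e t ⟨ht.2, htt⟩)
      have h2 : ContinuousWithinAt (fun t => h (G.edge e t)) {t | t ≤ G.len e ∧ t ≠ ⊤} t :=
        h1.congr (fun s hs => hfin _ (edge_mem_finitePoints hs.1 hs.2))
          (hfin _ (edge_mem_finitePoints ht.2 htt))
      refine h2.mono_of_mem_nhdsWithin ?_
      filter_upwards [self_mem_nhdsWithin, nhdsWithin_le_nhds (isOpen_ne.mem_nhds htt)]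
        with s hs hs'
      exact ⟨hs.2, hs'⟩
  · rw [hfin x hx]
    exact ⟨EReal.coe_ne_bot _, EReal.coe_ne_top _⟩
  · obtain ⟨P, hP, hPD, hPa⟩ := hF e
    refine ⟨P, hP, hPD, fun I hI => ?_⟩
    obtain ⟨hIo, a, b, hab⟩ := hPa I hI
    refine ⟨hIo, a, b, fun t ht => ?_⟩
    exact (hfin _ (edge_mem_finitePoints ht.2.2 ENNReal.ofReal_ne_top)).trans (hab t ht)

/-- The sum of two rational functions on the finite points extends to a rational function. -/
theorem Rat.exists_mul (f g : G.Rat) : ∃ h : G.Rat, ∀ x ∈ G.finitePoints, h x = f x + g x := by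
  obtain ⟨f, hf⟩ := f
  obtain ⟨g, hg⟩ := g
  rcases hf.2 with hf' | ⟨hf', hf''⟩
  · exact ⟨⟨f, hf⟩, fun x _ => by simp [hf']⟩
  rcases hg.2 with hg' | ⟨hg', hg''⟩
  · exact ⟨⟨g, hg⟩, fun x _ => by simp [hg']⟩
  have key : ∀ x ∈ G.finitePoints,
      (((f x).toReal + (g x).toReal : ℝ) : EReal) = f x + g x := by
    intro x hx
    rw [EReal.coe_add, EReal.coe_toReal (hf' x hx).2 (hf' x hx).1,
      EReal.coe_toReal (hg' x hx).2 (hg' x hx).1]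
  have hcont : ∀ f : G.Point → EReal, Continuous f →
      (∀ x ∈ G.finitePoints, f x ≠ ⊥ ∧ f x ≠ ⊤) → ∀ e,
      ContinuousOn (fun t => (f (G.edge e t)).toReal) {t | t ≤ G.len e ∧ t ≠ ⊤} := by
    intro f hf hf' e t ht
    have h1 := (continuous_iff.1 hf e t ⟨zero_le, ht.1⟩).mono
      (fun s (hs : s ∈ {t | t ≤ G.len e ∧ t ≠ ⊤}) => ⟨zero_le, hs.1⟩)
    have h2 := hf' _ (edge_mem_finitePoints ht.1 ht.2)
    exact (EReal.tendsto_toReal h2.2 h2.1).comp h1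
  obtain ⟨h, hh, hfin⟩ := exists_isRational (G := G)
    (F := fun x => (f x).toReal + (g x).toReal)
    (fun e => (hcont f hf.1 hf' e).add (hcont g hg.1 hg' e))
    (fun e => (hf'' e).add (hg'' e)
      (fun t ht => key _ (edge_mem_finitePoints ht.2 ENNReal.ofReal_ne_top)))
  exact ⟨⟨h, hh⟩, fun x hx => (hfin x hx).trans (key x hx)⟩

namespace Rat

/-- The constant function with value `t ∈ ℝ ∪ {-∞}`. -/
noncomputable def const (t : TropicalReal) : G.Rat := ⟨fun _ => t.toEReal, isRational_const t⟩

noncomputable instance : Zero G.Rat := ⟨const 0⟩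

noncomputable instance : One G.Rat := ⟨const 1⟩

/-- Tropical addition is the pointwise maximum (which is continuous, also at infinity). -/
noncomputable instance : Add G.Rat :=
  ⟨fun f g => ⟨fun x => max (f x) (g x), isRational_max f.2 g.2⟩⟩

/-- Tropical multiplication is the pointwise sum at the finite points, extended by continuity to
the points at infinity. -/
noncomputable instance : Mul G.Rat := ⟨fun f g => (exists_mul f g).choose⟩

theorem zero_apply (x : G.Point) : (0 : G.Rat) x = ⊥ := rfl

theorem one_apply (x : G.Point) : (1 : G.Rat) x = 0 := rfl

theorem add_apply (f g : G.Rat) (x : G.Point) : (f + g) x = max (f x) (g x) := rfl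

theorem mul_apply (f g : G.Rat) {x : G.Point} (hx : x ∈ G.finitePoints) :
    (f * g) x = f x + g x := (exists_mul f g).choose_spec x hx

/-- The rational function semifield. -/
noncomputable instance : CommSemiring G.Rat where
  add_assoc f g h := ext_finite fun x _ => by simp only [add_apply, max_assoc]
  zero_add f := ext_finite fun x _ => by simp [add_apply, zero_apply]
  add_zero f := ext_finite fun x _ => by simp [add_apply, zero_apply]
  add_comm f g := ext_finite fun x _ => by simp only [add_apply, max_comm]
  nsmul := nsmulRec
  left_distrib f g h := ext_finite fun x hx => by
    simp only [add_apply, mul_apply _ _ hx, add_max]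
  right_distrib f g h := ext_finite fun x hx => by
    simp only [add_apply, mul_apply _ _ hx, max_add]
  zero_mul f := ext_finite fun x hx => by simp [mul_apply _ _ hx, zero_apply]
  mul_zero f := ext_finite fun x hx => by simp [mul_apply _ _ hx, zero_apply]
  mul_assoc f g h := ext_finite fun x hx => by simp only [mul_apply _ _ hx, add_assoc]
  one_mul f := ext_finite fun x hx => by simp [mul_apply _ _ hx, one_apply]
  mul_one f := ext_finite fun x hx => by simp [mul_apply _ _ hx, one_apply]
  mul_comm f g := ext_finite fun x hx => by simp only [mul_apply _ _ hx, add_comm]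

/-- `Rat G` is an algebra over the tropical semifield through the constant functions. -/
noncomputable instance : Algebra TropicalReal G.Rat :=
  RingHom.toAlgebra
    { toFun := const
      map_zero' := rfl
      map_one' := rfl
      map_add' := fun s t => ext_finite fun _ _ => TropicalReal.toEReal_add s t
      map_mul' := fun s t => ext_finite fun x hx => by
        rw [mul_apply _ _ hx]
        exact TropicalReal.toEReal_mul s t }

theorem algebraMap_apply (t : TropicalReal) (x : G.Point) :
    (algebraMap TropicalReal G.Rat t) x = t.toEReal := rfl

end Rat

/-- The chip-firing move `x ↦ -min (l, dist (x, S))` by a subset `S` and `l ∈ (0, ∞]`. -/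
noncomputable def chipFiring (S : Set G.Point) (l : ℝ≥0∞) (x : G.Point) : EReal :=
  -((min l (⨅ y ∈ S, G.dist x y) : ℝ≥0∞) : EReal)

/-- For an edge `e` of infinite length, the part `(y, x]` of `e` between the point `y` with
parameter `t` (excluded) and the point `x` at infinity (included). -/
def ray (e : G.E) (t : ℝ≥0∞) : Set G.Point := G.edge e '' Set.Ioc t ⊤

variable {G₁ G₂ : EdgeWeightedGraph}

/-- The map `φ` between tropical curves is induced by the isomorphism `ψ` of their rational function
semifields, where `r = ψ(1)`: a finite point `x` goes to the finite point `φ x` with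
`ψ (CF({x}; ε)) = CF({φ x}; r ε)` for some `ε > 0`; a point `x` at infinity goes to the point `φ x`
at infinity such that, for some finite point `y` on the infinite edge at `x`, the point `φ y` is on
the infinite edge at `φ x` and `ψ (CF(Γ₁ \ (y, x]; ∞)) = CF(Γ₂ \ (φ y, φ x]; ∞)`. -/
def IsInducedBy (ψ : G₁.Rat ≃+* G₂.Rat) (r : ℝ) (φ : G₁.Point → G₂.Point) : Prop :=
  (∀ x ∈ G₁.finitePoints, φ x ∈ G₂.finitePoints ∧
    ∃ ε : ℝ, 0 < ε ∧ ∃ f : G₁.Rat, f.1 = chipFiring {x} (ENNReal.ofReal ε) ∧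
      (ψ f).1 = chipFiring {φ x} (ENNReal.ofReal (r * ε))) ∧
  (∀ x ∈ G₁.infinitePoints, φ x ∈ G₂.infinitePoints ∧
    ∃ e₁ e₂ t₁ t₂, G₁.len e₁ = ⊤ ∧ G₁.edge e₁ ⊤ = x ∧ t₁ ≠ ⊤ ∧
      G₂.len e₂ = ⊤ ∧ G₂.edge e₂ ⊤ = φ x ∧ t₂ ≠ ⊤ ∧ φ (G₁.edge e₁ t₁) = G₂.edge e₂ t₂ ∧
      ∃ f : G₁.Rat, f.1 = chipFiring (ray e₁ t₁)ᶜ ⊤ ∧ (ψ f).1 = chipFiring (ray e₂ t₂)ᶜ ⊤)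

/-- An `r`-expansive map: a continuous bijection that restricts to a bijection between the finite
points which multiplies all distances by `r`. -/
def IsExpansive (r : ℝ) (φ : G₁.Point → G₂.Point) : Prop :=
  Continuous φ ∧ Function.Bijective φ ∧ Set.BijOn φ G₁.finitePoints G₂.finitePoints ∧
    ∀ x ∈ G₁.finitePoints, ∀ y ∈ G₁.finitePoints,
      G₂.dist (φ x) (φ y) = ENNReal.ofReal r * G₁.dist x y

/-- An edge of `G` as a closed subset of the tropical curve. -/
def edgeSet (e : G.E) : Set G.Point := G.edge e '' Set.Icc 0 (G.len e)

/-- `v` is an endpoint of `e`. -/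
def Incident (v : G.V) (e : G.E) : Prop := G.src e = v ∨ G.tgt e = v

/-- `H` is a loopless model of the tropical curve given by `G`, through the identification `h` of
the two realizations. -/
def IsLooplessModel (H G : EdgeWeightedGraph) (h : H.Point ≃ₜ G.Point) : Prop :=
  (∀ x y, G.dist (h x) (h y) = H.dist x y) ∧ ∀ e, H.src e ≠ H.tgt e

open Classical in
/-- `φ` is a finite harmonic morphism of degree `d`. In terms of loopless models `H₁`, `H₂` of the
two tropical curves, `vert` and `edg` are the maps which `φ` induces on vertices and edges,
`degE e` is the factor by which `φ` stretches `e`, and `degV v` is the degree of `φ` at `v`.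
A map between singletons has every positive integer as a degree. -/
def IsFiniteHarmonicOfDegree (φ : G₁.Point → G₂.Point) (d : ℕ) : Prop :=
  Continuous φ ∧
  if Subsingleton G₁.Point ∧ Subsingleton G₂.Point then 0 < d else
  ∃ (H₁ H₂ : EdgeWeightedGraph) (h₁ : H₁.Point ≃ₜ G₁.Point) (h₂ : H₂.Point ≃ₜ G₂.Point)
    (vert : H₁.V → H₂.V) (edg : H₁.E → H₂.E) (degE : H₁.E → ℕ) (degV : H₁.V → ℕ),
    IsLooplessModel H₁ G₁ h₁ ∧ IsLooplessModel H₂ G₂ h₂ ∧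
    (∀ v, φ (h₁ (.vertex v)) = h₂ (.vertex (vert v))) ∧
    (∀ e, φ '' (h₁ '' edgeSet e) = h₂ '' edgeSet (edg e)) ∧
    (∀ e, 0 < degE e ∧ ∀ x ∈ h₁ '' edgeSet e, ∀ y ∈ h₁ '' edgeSet e,
      G₂.dist (φ x) (φ y) = degE e * G₁.dist x y) ∧
    (∀ v, ∀ e', Incident (vert v) e' →
      ∑ e : H₁.E with edg e = e' ∧ Incident v e, degE e = degV v) ∧
    (∀ v', ∑ v : H₁.V with vert v = v', degV v = d)

end EdgeWeightedGraph

/-! The points of a tropical curve can be recovered from the values that rational functions take, so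
`ψ` is composition with a homeomorphism followed by a rescaling of values.

The scaling factor comes from the constants. Slopes are integers, so a nonzero function with roots
of all orders has slopes divisible by every positive integer, hence zero (`Rat.exists_eq_ofReal`).
Thus `ψ` preserves the real constants, and there it is additive and increasing, i.e. multiplication
by some `r > 0` (`Rat.exists_map_ofReal`).

For finite `y`, the image `φ y` is the common solution `z` of the closed conditions `ψ f z = r * f
y`. If there were none, compactness would give finitely many `f` whose conditions are incompatible.
Let `g` be the maximum of the functions `|f - f y|` for these `f`; it is expressible by semifield
operations. Then `g y ≤ 0` while `ψ g > 0` everywhere, so `ψ g` absorbs a positive constant under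
maximum; then so does `g`, which is false at `y`. Density of the finite points, compactness and the
same construction for `ψ.symm` yield a homeomorphism (`exists_homeomorph`).

For the metric, pull `-dist (φ x, ·)` back by `ψ` and push `-dist (x, ·)` forward. Both results have
integer slopes, say `a` and `k`. Computing the local stretching of `φ` from each gives `a * k = ±1`,
so `a = ±1` (`abs_slope_le_one`). Hence `φ` stretches distances at most by `r` (`dist_map_le`), and
applying this to the inverse gives equality (`dist_map_eq`).

The chip-firing moves are built from distances and constants, so they correspond under `ψ`
(`isInducedBy`); a value `0` or `-∞` of such a move identifies its centre, which gives uniqueness.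
For `r = 1` the map is an isometry, and a loopless model of the source serves for the target too,
with all degrees one. -/

namespace EdgeWeightedGraph

/-! ### Paths and distances -/

variable {G : EdgeWeightedGraph}

/-- Only an isolated vertex could lie on no edge. Being an endpoint of some edge is invariant under
the relation that generates connectedness, so a single edge excludes isolated vertices. -/
theorem exists_edge_eq [Nonempty G.E] (x : G.Point) : ∃ e t, t ≤ G.len e ∧ G.edge e t = x := by
  have key : ∀ v w : G.V, Relation.EqvGen (fun a b => ∃ e, G.src e = a ∧ G.tgt e = b) v w →
      ((∃ e, G.src e = v ∨ G.tgt e = v) ↔ (∃ e, G.src e = w ∨ G.tgt e = w)) := by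
    intro v w h
    induction h with
    | rel a b h =>
      obtain ⟨e, rfl, rfl⟩ := h
      exact ⟨fun _ => ⟨e, Or.inr rfl⟩, fun _ => ⟨e, Or.inl rfl⟩⟩
    | refl a => rfl
    | symm a b _ ih => exact ih.symm
    | trans a b c _ _ ih ih' => exact ih.trans ih'
  cases x with
  | vertex v =>
    obtain ⟨e₀⟩ := ‹Nonempty G.E›
    obtain ⟨e, he | he⟩ := (key _ v (G.connected (G.src e₀) v)).1 ⟨e₀, Or.inl rfl⟩
    · exact ⟨e, 0, zero_le, by rw [edge_zero, he]⟩
    · exact ⟨e, G.len e, le_rfl, by rw [edge_len, he]⟩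
  | inner e t h h' => exact ⟨e, t, h'.le, edge_inner e t h h'⟩

theorem edge_eq_inner_iff {e e' : G.E} {t s : ℝ≥0∞} {h : 0 < s} {h' : s < G.len e} :
    G.edge e' t = .inner e s h h' ↔ e' = e ∧ t = s := by
  constructor
  · intro heq
    unfold edge at heq
    split_ifs at heq with h1
    cases heq
    exact ⟨rfl, rfl⟩
  · rintro ⟨rfl, rfl⟩
    exact edge_inner _ _ h h'

theorem edge_eq_vertex {e : G.E} {t : ℝ≥0∞} (ht : t ≤ G.len e) {v : G.V}
    (h : G.edge e t = .vertex v) : (t = 0 ∧ G.src e = v) ∨ (t = G.len e ∧ G.tgt e = v) := by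
  rcases eq_or_ne t 0 with rfl | h0
  · rw [edge_zero] at h
    exact Or.inl ⟨rfl, Point.vertex.inj h⟩
  rcases ht.lt_or_eq with h1 | rfl
  · rw [edge_inner e t (pos_iff_ne_zero.2 h0) h1] at h
    cases h
  · rw [edge_len] at h
    exact Or.inr ⟨rfl, Point.vertex.inj h⟩

namespace IsPath

theorem trans {x y z : G.Point} {ℓ ℓ' : ℝ≥0∞} (h : G.IsPath x y ℓ) (h' : G.IsPath y z ℓ') :
    G.IsPath x z (ℓ + ℓ') := by
  induction h' with
  | nil => simpa using h
  | snoc e s t hs ht hy hz _ ih =>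
    rw [← add_assoc]
    exact .snoc e s t hs ht hy hz ih

theorem symm {x y : G.Point} {ℓ : ℝ≥0∞} (h : G.IsPath x y ℓ) : G.IsPath y x ℓ := by
  induction h with
  | nil => exact .nil
  | snoc e s t hs ht hy hz _ ih =>
    have h1 := IsPath.snoc e t s ht hs hz hy (IsPath.nil (G := G))
    have h2 := h1.trans ih
    rwa [zero_add, add_comm, add_comm (t - s)] at h2

/-- A function that is `1`-Lipschitz along every edge is `1`-Lipschitz along paths. -/
theorem le_add {F : G.Point → ℝ≥0∞}
    (hF : ∀ e s t, s ≤ G.len e → t ≤ G.len e →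
      F (G.edge e t) ≤ F (G.edge e s) + ((s - t) + (t - s)))
    {x z : G.Point} {ℓ : ℝ≥0∞} (h : G.IsPath x z ℓ) : F z ≤ F x + ℓ := by
  induction h with
  | nil => simp
  | snoc e s t hs ht hy hz _ ih =>
    subst hy hz
    rw [← add_assoc]
    exact (hF e s t hs ht).trans (by gcongr)

end IsPath

/-- The main source of lower bounds on `dist`: paths need not be analysed, it is enough to exhibit a
function that is 1-Lipschitz along each edge. -/
theorem le_add_dist {F : G.Point → ℝ≥0∞}
    (hF : ∀ e s t, s ≤ G.len e → t ≤ G.len e →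
      F (G.edge e t) ≤ F (G.edge e s) + ((s - t) + (t - s)))
    (x z : G.Point) : F z ≤ F x + G.dist x z := by
  unfold dist
  rw [ENNReal.add_sInf]
  exact le_iInf₂ fun ℓ h => h.le_add hF

theorem dist_le_of_isPath {x z : G.Point} {ℓ : ℝ≥0∞} (h : G.IsPath x z ℓ) : G.dist x z ≤ ℓ :=
  sInf_le h

theorem dist_self (x : G.Point) : G.dist x x = 0 :=
  le_antisymm (dist_le_of_isPath .nil) zero_le

theorem dist_comm (x y : G.Point) : G.dist x y = G.dist y x := by
  unfold dist
  congr 1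
  ext ℓ
  exact ⟨IsPath.symm, IsPath.symm⟩

theorem dist_edge_le (x : G.Point) (e : G.E) (s t : ℝ≥0∞) (hs : s ≤ G.len e) (ht : t ≤ G.len e) :
    G.dist x (G.edge e t) ≤ G.dist x (G.edge e s) + ((s - t) + (t - s)) := by
  conv_rhs => unfold dist
  rw [ENNReal.sInf_add]
  exact le_iInf₂ fun ℓ h => dist_le_of_isPath (.snoc e s t hs ht rfl rfl h)

theorem sub_add_sub_triangle (s u t : ℝ≥0∞) :
    (s - t) + (t - s) ≤ ((s - u) + (u - s)) + ((u - t) + (t - u)) := by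
  calc (s - t) + (t - s) ≤ ((s - u) + (u - t)) + ((t - u) + (u - s)) :=
        add_le_add tsub_le_tsub_add_tsub tsub_le_tsub_add_tsub
    _ = _ := by ring

theorem le_add_sub_add_sub (s t : ℝ≥0∞) : t ≤ s + ((s - t) + (t - s)) := by
  calc t ≤ s + (t - s) := le_add_tsub
    _ ≤ _ := by gcongr; exact le_add_self

theorem sub_le_sub_add (l s t : ℝ≥0∞) : l - t ≤ (l - s) + ((s - t) + (t - s)) := by
  calc l - t ≤ (l - s) + (s - t) := tsub_le_tsub_add_tsub
    _ ≤ _ := by gcongr; exact le_self_add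

/-- On the edge `e`, the distance to `x` is realized through one of the ends of `e`, or along `e`. -/
theorem dist_edge_cases (x : G.Point) (e : G.E) (t : ℝ≥0∞) (ht : t ≤ G.len e) :
    G.dist x (G.edge e t) = G.dist x (.vertex (G.src e)) + t ∨
    G.dist x (G.edge e t) = G.dist x (.vertex (G.tgt e)) + (G.len e - t) ∨
    ∃ s h h', x = .inner e s h h' ∧ G.dist x (G.edge e t) = (s - t) + (t - s) := by
  -- The claim is made for all representations `(e, t)` of the endpoint, since a vertex lies on
  -- several edges. At a vertex the first or second alternative holds with nothing left to travel.
  -- At an inner point the last segment lies in `e`, and the triangle inequality carries each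
  -- alternative from `s` to `t`.
  have path : ∀ z ℓ, G.IsPath x z ℓ → ∀ e t, t ≤ G.len e → G.edge e t = z →
      G.dist x (.vertex (G.src e)) + t ≤ ℓ ∨
      G.dist x (.vertex (G.tgt e)) + (G.len e - t) ≤ ℓ ∨
      ∃ s h h', x = .inner e s h h' ∧ (s - t) + (t - s) ≤ ℓ := by
    have vert : ∀ v ℓ, G.IsPath x (.vertex v) ℓ → ∀ e t, t ≤ G.len e → G.edge e t = .vertex v →
        G.dist x (.vertex (G.src e)) + t ≤ ℓ ∨
        G.dist x (.vertex (G.tgt e)) + (G.len e - t) ≤ ℓ := by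
      intro v ℓ h e t ht hz
      rcases edge_eq_vertex ht hz with ⟨rfl, rfl⟩ | ⟨rfl, rfl⟩
      · left
        simpa using dist_le_of_isPath h
      · right
        simpa using dist_le_of_isPath h
    intro z ℓ h
    induction h with
    | nil =>
      intro e t ht hz
      cases x with
      | vertex v => exact (vert v 0 .nil e t ht hz).imp_right Or.inl
      | inner e' s h h' =>
        obtain ⟨rfl, rfl⟩ := edge_eq_inner_iff.1 hz
        exact Or.inr (Or.inr ⟨t, h, h', rfl, by simp⟩)
    | @snoc y z ℓ e' s t' hs ht' hy hz hp ih =>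
      intro e t ht hz'
      cases z with
      | vertex v =>
        exact (vert v _ (.snoc e' s t' hs ht' hy hz hp) e t ht hz').imp_right Or.inl
      | inner e₁ t₁ h₁ h₁' =>
        obtain ⟨rfl, rfl⟩ := edge_eq_inner_iff.1 hz
        obtain ⟨rfl, rfl⟩ := edge_eq_inner_iff.1 hz'
        rcases ih e s hs hy with h | h | ⟨s', h, h', hx, hl⟩
        · left
          calc _ ≤ G.dist x (.vertex (G.src e)) + (s + ((s - t) + (t - s))) := by
                gcongr; exact le_add_sub_add_sub s t
            _ ≤ _ := by rw [← add_assoc]; gcongr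
        · right; left
          calc _ ≤ G.dist x (.vertex (G.tgt e)) + ((G.len e - s) + ((s - t) + (t - s))) := by
                gcongr; exact sub_le_sub_add _ s t
            _ ≤ _ := by rw [← add_assoc]; gcongr
        · right; right
          exact ⟨s', h, h', hx, (sub_add_sub_triangle s' s t).trans (by gcongr)⟩
  have hA : G.dist x (G.edge e t) ≤ G.dist x (.vertex (G.src e)) + t := by
    simpa [edge_zero] using dist_edge_le x e 0 t zero_le ht
  have hB : G.dist x (G.edge e t) ≤ G.dist x (.vertex (G.tgt e)) + (G.len e - t) := by
    simpa [edge_len, tsub_eq_zero_of_le ht] using dist_edge_le x e (G.len e) t le_rfl ht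
  have hC : ∀ s h h', x = .inner e s h h' → G.dist x (G.edge e t) ≤ (s - t) + (t - s) := by
    rintro s h h' rfl
    have := dist_edge_le (.inner e s h h') e s t h'.le ht
    rwa [edge_inner e s h h', dist_self, zero_add] at this
  by_contra! hcon
  obtain ⟨h1, h2, h3⟩ := hcon
  replace h1 := hA.lt_of_ne h1
  replace h2 := hB.lt_of_ne h2
  -- The infimum defining `dist` is not known to be attained. If it is strictly below all
  -- candidates, some path is too, against `path`. Here `c` is the third candidate, or just a larger
  -- number when `x` is not inside `e`.
  obtain ⟨c, hc, hcx⟩ : ∃ c, G.dist x (G.edge e t) < c ∧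
      ∀ s h h', x = .inner e s h h' → c ≤ (s - t) + (t - s) := by
    by_cases hx : ∃ s h h', x = .inner e s h h'
    · obtain ⟨s, h, h', rfl⟩ := hx
      refine ⟨_, (hC s h h' rfl).lt_of_ne (h3 s h h' rfl), fun s' _ _ heq => ?_⟩
      cases heq
      exact le_rfl
    · exact ⟨_, h1, fun s h h' heq => (hx ⟨s, h, h', heq⟩).elim⟩
  obtain ⟨ℓ, hp, hℓ⟩ := sInf_lt_iff.1 (lt_min (lt_min h1 h2) hc)
  rcases path _ ℓ hp e t ht rfl with h | h | ⟨s, h, h', hx, hl⟩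
  · exact absurd (hℓ.trans_le ((min_le_left _ _).trans (min_le_left _ _))) (not_lt.2 h)
  · exact absurd (hℓ.trans_le ((min_le_left _ _).trans (min_le_right _ _))) (not_lt.2 h)
  · exact absurd ((hℓ.trans_le (min_le_right _ _)).trans_le (hcx s h h' hx)) (not_lt.2 hl)

theorem src_mem_finitePoints (e : G.E) : (.vertex (G.src e) : G.Point) ∈ G.finitePoints := by
  rw [← edge_zero]
  exact edge_mem_finitePoints zero_le ENNReal.zero_ne_top

theorem inner_mem_finitePoints {e : G.E} {t : ℝ≥0∞} (h : 0 < t) (h' : t < G.len e) :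
    (.inner e t h h' : G.Point) ∈ G.finitePoints := by
  rw [← edge_inner]
  exact edge_mem_finitePoints h'.le (h'.trans_le le_top).ne

theorem dist_ne_top {x y : G.Point} (hx : x ∈ G.finitePoints) (hy : y ∈ G.finitePoints) :
    G.dist x y ≠ ⊤ := by
  -- At the end of an infinite edge the first clause is vacuous, so the second one records
  -- finiteness at the other end. With this, `Q` passes along every edge, infinite ones included.
  let Q : G.V → Prop := fun v => ((.vertex v : G.Point) ∈ G.finitePoints →
    G.dist x (.vertex v) ≠ ⊤) ∧ ∀ e, G.tgt e = v → G.len e = ⊤ → G.dist x (.vertex (G.src e)) ≠ ⊤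
  have hsrc : ∀ e, Q (G.src e) ↔ G.dist x (.vertex (G.src e)) ≠ ⊤ := fun e =>
    ⟨fun h => h.1 (src_mem_finitePoints e), fun h => ⟨fun _ => h, fun e' h1 h2 =>
      (src_ne_of_len_eq_top h2 e h1.symm).elim⟩⟩
  have htgt : ∀ e, Q (G.tgt e) ↔ G.dist x (.vertex (G.src e)) ≠ ⊤ := by
    intro e
    by_cases he : G.len e = ⊤
    · refine ⟨fun h => h.2 e rfl he, fun h => ⟨fun h' => ?_, fun e' h1 _ => ?_⟩⟩
      · exact (h' ⟨e, he, (edge_top he).symm⟩).elim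
      · rwa [eq_of_tgt_eq he h1]
    · have hfin : (.vertex (G.tgt e) : G.Point) ∈ G.finitePoints := by
        rw [← edge_len]; exact edge_mem_finitePoints le_rfl he
      have h1 := dist_edge_le x e 0 (G.len e) zero_le le_rfl
      have h2 := dist_edge_le x e (G.len e) 0 le_rfl zero_le
      simp only [edge_zero, edge_len, tsub_zero, zero_tsub, zero_add, add_zero] at h1 h2
      refine ⟨fun h h' => ?_, fun h => ⟨fun _ h' => ?_, fun e' h1 h2 => ?_⟩⟩
      · rw [h', top_le_iff, ENNReal.add_eq_top] at h2
        exact h2.elim (h.1 hfin) he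
      · rw [h', top_le_iff, ENNReal.add_eq_top] at h1
        exact h1.elim h he
      · exact (he (eq_of_tgt_eq h2 h1.symm ▸ h2)).elim
  have hQ : ∀ v w : G.V, Relation.EqvGen (fun a b => ∃ e, G.src e = a ∧ G.tgt e = b) v w →
      (Q v ↔ Q w) := by
    intro v w h
    induction h with
    | rel a b h =>
      obtain ⟨e, rfl, rfl⟩ := h
      rw [hsrc, htgt]
    | refl a => rfl
    | symm a b _ ih => exact ih.symm
    | trans a b c _ _ ih ih' => exact ih.trans ih'
  have hall : ∀ w, Q w := by
    obtain ⟨v, hv⟩ : ∃ v, Q v := by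
      cases x with
      | vertex v =>
        refine ⟨v, fun _ => by simp [dist_self], fun e h he => ?_⟩
        subst h
        exact (hx ⟨e, he, (edge_top he).symm⟩).elim
      | inner e s h h' =>
        refine ⟨G.src e, (hsrc e).2 ?_⟩
        have := dist_edge_le (.inner e s h h') e s 0 h'.le zero_le
        rw [edge_inner e s h h', dist_self, edge_zero] at this
        exact ne_top_of_le_ne_top (by simpa using (h'.trans_le le_top).ne) this
    exact fun w => (hQ v w (G.connected v w)).1 hv
  cases y with
  | vertex v => exact (hall v).1 hy
  | inner e t h h' =>
    have := dist_edge_le x e 0 t zero_le h'.le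
    rw [edge_inner e t h h', edge_zero] at this
    exact ne_top_of_le_ne_top (ENNReal.add_ne_top.2
      ⟨(hsrc e).1 (hall _), by simpa using (h'.trans_le le_top).ne⟩) this

/-! ### Rays and points at infinity -/

open Classical in
/-- For an edge `e` of infinite length, the distance from the complement of the ray
`G.ray e t`. -/
noncomputable def rayDist (e : G.E) (t : ℝ≥0∞) : G.Point → ℝ≥0∞
  | .vertex v => if G.tgt e = v then ⊤ - t else 0
  | .inner e' s _ _ => if e' = e then s - t else 0

open Classical in
theorem rayDist_edge {e : G.E} (he : G.len e = ⊤) (t : ℝ≥0∞) {e' : G.E} {s : ℝ≥0∞}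
    (hs : s ≤ G.len e') : rayDist e t (G.edge e' s) = if e' = e then s - t else 0 := by
  rcases eq_or_ne s 0 with rfl | h0
  · rw [edge_zero]
    simp [rayDist, (src_ne_of_len_eq_top he e').symm]
  rcases hs.lt_or_eq with h1 | rfl
  · rw [edge_inner e' s (pos_iff_ne_zero.2 h0) h1]
    rfl
  · rw [edge_len]
    simp only [rayDist]
    by_cases h : e' = e
    · subst h
      simp [he]
    · rw [if_neg h, if_neg]
      exact fun h' => h (eq_of_tgt_eq he h'.symm)

theorem rayDist_lipschitz {e : G.E} (he : G.len e = ⊤) (t : ℝ≥0∞) (e' : G.E) (s u : ℝ≥0∞)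
    (hs : s ≤ G.len e') (hu : u ≤ G.len e') :
    rayDist e t (G.edge e' u) ≤ rayDist e t (G.edge e' s) + ((s - u) + (u - s)) := by
  rw [rayDist_edge he t hs, rayDist_edge he t hu]
  split_ifs with h
  · calc u - t ≤ (u - s) + (s - t) := tsub_le_tsub_add_tsub
      _ ≤ _ := by rw [add_comm]; gcongr; exact le_add_self
  · exact zero_le

theorem rayDist_ne_top {e : G.E} (he : G.len e = ⊤) (t : ℝ≥0∞) {x : G.Point}
    (hx : x ∈ G.finitePoints) : rayDist e t x ≠ ⊤ := by
  cases x with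
  | vertex v =>
    simp only [rayDist]
    rw [if_neg]
    · simp
    · rintro rfl
      exact hx ⟨e, he, (edge_top he).symm⟩
  | inner e' s h h' =>
    simp only [rayDist]
    split_ifs
    · exact ne_top_of_le_ne_top (h'.trans_le le_top).ne tsub_le_self
    · simp

/-- `rayDist e 0` is 1-Lipschitz along edges, infinite at the end of `e` and finite everywhere else.
-/
theorem dist_edge_top {e : G.E} (he : G.len e = ⊤) {x : G.Point} (hx : x ≠ G.edge e ⊤) :
    G.dist x (G.edge e ⊤) = ⊤ := by
  have h := le_add_dist (rayDist_lipschitz he 0) x (G.edge e ⊤)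
  rw [rayDist_edge he 0 (he ▸ le_rfl), if_pos rfl, tsub_zero, top_le_iff, ENNReal.add_eq_top] at h
  refine h.resolve_left ?_
  cases x with
  | vertex v =>
    simp only [rayDist]
    rw [if_neg]
    · simp
    · rintro rfl
      exact hx (edge_top he).symm
  | inner e' s h1 h2 => exact rayDist_ne_top he 0 (inner_mem_finitePoints h1 h2)

theorem dist_of_mem_infinitePoints {x y : G.Point} (hy : y ∈ G.infinitePoints) (hxy : x ≠ y) :
    G.dist x y = ⊤ := by
  obtain ⟨e, he, rfl⟩ := hy
  exact dist_edge_top he hxy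

-- A tent around `v` bounds the distance from below: `F` measures the distance to `v` inside the
-- edges at `v` and is capped at a height `δ` not exceeding any edge length. The cap makes the
-- formulas of different edges agree at the vertices other than `v`.
open Classical in
theorem dist_vertex_pos {x : G.Point} {v : G.V} (hx : x ≠ .vertex v) :
    0 < G.dist x (.vertex v) := by
  obtain ⟨δ, hδ, hδe⟩ : ∃ δ : ℝ≥0∞, 0 < δ ∧ ∀ e, δ ≤ G.len e := by
    refine ⟨Finset.univ.inf G.len, ?_, fun e => Finset.inf_le (Finset.mem_univ e)⟩
    exact (Finset.lt_inf_iff ENNReal.zero_lt_top).2 fun e _ => G.len_pos e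
  let fe : G.E → ℝ≥0∞ → ℝ≥0∞ := fun e t => min (min (if G.src e = v then t else ⊤)
    (if G.tgt e = v then G.len e - t else ⊤)) δ
  let F : G.Point → ℝ≥0∞ := fun p => match p with
    | .vertex w => if w = v then 0 else δ
    | .inner e t _ _ => fe e t
  have hF : ∀ e t, t ≤ G.len e → F (G.edge e t) = fe e t := by
    intro e t ht
    rcases eq_or_ne t 0 with rfl | h0
    · rw [edge_zero]
      by_cases h : G.src e = v
      · simp [F, fe, h]
      · simp only [F, fe, h, if_false, tsub_zero]
        split_ifs <;> simp [hδe e]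
    rcases ht.lt_or_eq with h1 | rfl
    · rw [edge_inner e t (pos_iff_ne_zero.2 h0) h1]
    · rw [edge_len]
      by_cases h : G.tgt e = v
      · simp [F, fe, h]
      · simp only [F, fe, h, if_false]
        split_ifs <;> simp [hδe e]
  have hlip : ∀ e s t, s ≤ G.len e → t ≤ G.len e →
      F (G.edge e t) ≤ F (G.edge e s) + ((s - t) + (t - s)) := by
    intro e s t hs ht
    rw [hF e s hs, hF e t ht]
    simp only [fe]
    rw [min_add, min_add]
    refine min_le_min (min_le_min ?_ ?_) le_self_add
    · split_ifs
      · exact le_add_sub_add_sub s t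
      · simp
    · split_ifs
      · exact sub_le_sub_add _ s t
      · simp
  have h := le_add_dist hlip (.vertex v) x
  have h0 : F (.vertex v) = 0 := if_pos rfl
  rw [h0, zero_add, dist_comm] at h
  refine lt_of_lt_of_le ?_ h
  cases x with
  | vertex w =>
    have : F (.vertex w) = δ := if_neg fun hw => hx (congrArg Point.vertex hw)
    rwa [this]
  | inner e t h1 h2 =>
    refine lt_min (lt_min ?_ ?_) hδ
    · split_ifs
      · exact h1
      · simp
    · split_ifs
      · exact tsub_pos_of_lt h2
      · simp

theorem eq_of_dist_eq_zero {x y : G.Point} (h : G.dist x y = 0) : x = y := by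
  by_contra hxy
  cases y with
  | vertex v => exact (dist_vertex_pos hxy).ne' h
  | inner e t h1 h2 =>
    have := dist_edge_cases x e t h2.le
    rw [edge_inner e t h1 h2, h] at this
    rcases this with h3 | h3 | ⟨s, h3, h4, rfl, h5⟩
    · exact h1.ne' (add_eq_zero.1 h3.symm).2
    · exact (tsub_pos_of_lt h2).ne' (add_eq_zero.1 h3.symm).2
    · have h6 := add_eq_zero.1 h5.symm
      have := le_antisymm (tsub_eq_zero_iff_le.1 h6.1) (tsub_eq_zero_iff_le.1 h6.2)
      subst this
      exact hxy rfl

/-- From inside the ray, the complement is reached at the boundary point `G.edge e t`; the opposite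
bound holds because `rayDist e t` is 1-Lipschitz and vanishes on the complement. -/
theorem iInf_dist_compl_ray {e : G.E} (he : G.len e = ⊤) (t : ℝ≥0∞) (x : G.Point) :
    ⨅ y ∈ (ray e t)ᶜ, G.dist x y = rayDist e t x := by
  have hcompl : ∀ y ∈ (ray e t)ᶜ, rayDist e t y = 0 := by
    intro y hy
    have : Nonempty G.E := ⟨e⟩
    obtain ⟨e', s, hs, rfl⟩ := exists_edge_eq y
    rw [rayDist_edge he t hs]
    split_ifs with h
    · subst h
      rw [tsub_eq_zero_iff_le]
      by_contra! h
      exact hy ⟨s, ⟨h, le_top⟩, rfl⟩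
    · rfl
  apply le_antisymm
  · by_cases hx : x ∈ ray e t
    · obtain ⟨s, ⟨h1, h2⟩, rfl⟩ := hx
      rw [rayDist_edge he t (he ▸ h2), if_pos rfl]
      have hy : G.edge e t ∈ (ray e t)ᶜ := by
        rintro ⟨u, ⟨h3, h4⟩, h5⟩
        have := congrArg (rayDist e 0) h5
        rw [rayDist_edge he 0 (he ▸ le_top), rayDist_edge he 0 (he ▸ le_top)] at this
        simp only [if_true, tsub_zero] at this
        exact h3.ne' this
      refine (iInf₂_le _ hy).trans ?_
      rw [dist_comm]
      have := dist_edge_le (G.edge e t) e t s (he ▸ le_top) (he ▸ le_top)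
      rwa [dist_self, zero_add, tsub_eq_zero_of_le h1.le, zero_add] at this
    · refine (iInf₂_le x hx).trans ?_
      simp [dist_self]
  · refine le_iInf₂ fun y hy => ?_
    have := le_add_dist (rayDist_lipschitz he t) y x
    rwa [hcompl y hy, zero_add, dist_comm] at this

theorem chipFiring_compl_ray {e : G.E} (he : G.len e = ⊤) (t : ℝ≥0∞) (x : G.Point) :
    chipFiring (ray e t)ᶜ ⊤ x = -((rayDist e t x : ℝ≥0∞) : EReal) := by
  rw [chipFiring, iInf_dist_compl_ray he, min_eq_right le_top]

theorem chipFiring_singleton (x : G.Point) (l : ℝ≥0∞) (y : G.Point) :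
    chipFiring {x} l y = -((min l (G.dist x y) : ℝ≥0∞) : EReal) := by
  simp only [chipFiring, Set.mem_singleton_iff, iInf_iInf_eq_left, dist_comm y x]

end EdgeWeightedGraph

/-! ### Distances as rational functions -/

namespace IsPiecewiseAffineOn

variable {u v : ℝ → EReal} {D : Set ℝ}

theorem congr (hu : IsPiecewiseAffineOn u D) (h : ∀ t ∈ D, v t = u t) :
    IsPiecewiseAffineOn v D := by
  obtain ⟨P, hP, hPD, hPa⟩ := hu
  refine ⟨P, hP, hPD, fun I hI => ?_⟩
  obtain ⟨hIo, a, b, hab⟩ := hPa I hI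
  exact ⟨hIo, a, b, fun t ht => (h t ht.2).trans (hab t ht)⟩

theorem neg (hu : IsPiecewiseAffineOn u D) : IsPiecewiseAffineOn (fun t => -u t) D := by
  obtain ⟨P, hP, hPD, hPa⟩ := hu
  refine ⟨P, hP, hPD, fun I hI => ?_⟩
  obtain ⟨hIo, a, b, hab⟩ := hPa I hI
  refine ⟨hIo, -a, -b, fun t ht => ?_⟩
  simp only [hab t ht]
  rw [← EReal.coe_neg]
  congr 1
  push_cast
  ring

theorem affine (a : ℤ) (b : ℝ) : IsPiecewiseAffineOn (fun t => ((a * t + b : ℝ) : EReal)) D :=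
  ⟨{Set.univ}, Set.finite_singleton _, by simp, by
    rintro I rfl
    exact ⟨Set.ordConnected_univ, a, b, by simp⟩⟩

end IsPiecewiseAffineOn

namespace EdgeWeightedGraph

variable {G : EdgeWeightedGraph}

/-- The finite real parameters of the edge `e`. -/
def params (e : G.E) : Set ℝ := {t | 0 ≤ t ∧ ENNReal.ofReal t ≤ G.len e}

theorem ordConnected_params (e : G.E) : (params e).OrdConnected :=
  ⟨fun _ hx _ hy _ hz => ⟨hx.1.trans hz.1, (ENNReal.ofReal_le_ofReal hz.2).trans hy.2⟩⟩

theorem edge_ofReal_mem_finitePoints {e : G.E} {t : ℝ} (ht : t ∈ params e) :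
    G.edge e (ENNReal.ofReal t) ∈ G.finitePoints :=
  edge_mem_finitePoints ht.2 ENNReal.ofReal_ne_top

theorem toReal_mem_params {e : G.E} {t : ℝ≥0∞} (ht : t ≤ G.len e) (h : t ≠ ⊤) :
    t.toReal ∈ params e := ⟨ENNReal.toReal_nonneg, by rwa [ENNReal.ofReal_toReal h]⟩

/-- The Lipschitz bound is vacuous around `t = ⊤`, so continuity at infinity is always treated
separately. -/
theorem continuousWithinAt_of_lipschitz {F : ℝ≥0∞ → ℝ≥0∞} {l : ℝ≥0∞}
    (hF : ∀ s t, s ≤ l → t ≤ l → F t ≤ F s + ((s - t) + (t - s))) {t : ℝ≥0∞} (ht : t ≤ l)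
    (htop : t ≠ ⊤) : ContinuousWithinAt F (Set.Icc 0 l) t := by
  have hlim : Filter.Tendsto (fun s : ℝ≥0∞ => (s - t) + (t - s)) (𝓝[Set.Icc 0 l] t) (𝓝 0) := by
    have h1 : Filter.Tendsto (fun s : ℝ≥0∞ => s - t) (𝓝 t) (𝓝 (t - t)) :=
      ENNReal.Tendsto.sub Filter.tendsto_id tendsto_const_nhds (Or.inl htop)
    have h2 : Filter.Tendsto (fun s : ℝ≥0∞ => t - s) (𝓝 t) (𝓝 (t - t)) :=
      ENNReal.Tendsto.sub tendsto_const_nhds Filter.tendsto_id (Or.inl htop)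
    have := h1.add h2
    rw [tsub_self, add_zero] at this
    exact this.mono_left nhdsWithin_le_nhds
  have h3 : Filter.Tendsto (fun s : ℝ≥0∞ => F t + ((s - t) + (t - s))) (𝓝[Set.Icc 0 l] t)
      (𝓝 (F t)) := by
    simpa using (tendsto_const_nhds (x := F t)).add hlim
  have h4 : Filter.Tendsto (fun s : ℝ≥0∞ => F t - ((s - t) + (t - s))) (𝓝[Set.Icc 0 l] t)
      (𝓝 (F t)) := by
    simpa using ENNReal.Tendsto.sub (tendsto_const_nhds (x := F t)) hlim (Or.inr (by simp))
  refine tendsto_of_tendsto_of_tendsto_of_le_of_le' h4 h3 ?_ ?_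
  · filter_upwards [self_mem_nhdsWithin] with s hs
    exact tsub_le_iff_right.2 (hF s t hs.2 ht)
  · filter_upwards [self_mem_nhdsWithin] with s hs
    rw [add_comm (s - t)]
    exact hF t s ht hs.2

theorem isRational_neg_coe {F : G.Point → ℝ≥0∞} (hfin : ∀ x ∈ G.finitePoints, F x ≠ ⊤)
    (hc : ∀ e, ContinuousOn (fun t => F (G.edge e t)) (Set.Icc 0 (G.len e)))
    (hF : ∀ e, IsPiecewiseAffineOn (fun t => ((F (G.edge e (ENNReal.ofReal t)) : ℝ≥0∞) : EReal))
      (params e)) :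
    G.IsRational (fun x => -((F x : ℝ≥0∞) : EReal)) := by
  refine ⟨continuous_iff.2 fun e => ?_, Or.inr ⟨fun x hx => ?_, fun e => (hF e).neg⟩⟩
  · exact (continuous_coe_ennreal_ereal.neg).comp_continuousOn (hc e)
  · have := hfin x hx
    simp [EReal.neg_eq_bot_iff, EReal.neg_eq_top_iff, this]

theorem isRational_neg_rayDist {e : G.E} (he : G.len e = ⊤) {t : ℝ≥0∞} (ht : t ≠ ⊤) :
    G.IsRational (fun x => -((rayDist e t x : ℝ≥0∞) : EReal)) := by
  classical
  refine isRational_neg_coe (fun x hx => rayDist_ne_top he t hx) (fun e' => ?_) (fun e' => ?_)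
  · have : ContinuousOn (fun s : ℝ≥0∞ => if e' = e then s - t else 0) (Set.Icc 0 (G.len e')) := by
      split_ifs
      · exact fun s _ => (ENNReal.Tendsto.sub Filter.tendsto_id tendsto_const_nhds
          (Or.inr ht)).mono_left nhdsWithin_le_nhds
      · exact continuousOn_const
    exact this.congr fun s hs => rayDist_edge he t hs.2
  · by_cases h : e' = e
    · refine ((IsPiecewiseAffineOn.affine 1 (-t.toReal)).max (.const 0)).congr fun s hs => ?_
      rw [rayDist_edge he t hs.2, if_pos h]
      obtain ⟨b, hb, rfl⟩ : ∃ b : ℝ, 0 ≤ b ∧ t = ENNReal.ofReal b :=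
        ⟨t.toReal, ENNReal.toReal_nonneg, (ENNReal.ofReal_toReal ht).symm⟩
      rw [← ENNReal.ofReal_sub _ hb, EReal.coe_ennreal_ofReal, ENNReal.toReal_ofReal hb,
        EReal.coe_strictMono.monotone.map_max]
      simp [sub_eq_add_neg]
    · refine (IsPiecewiseAffineOn.const 0).congr fun s hs => ?_
      rw [rayDist_edge he t hs.2, if_neg h]
      simp

theorem abs_toReal_sub_le {F : ℝ≥0∞ → ℝ≥0∞} {l : ℝ≥0∞}
    (hF : ∀ s t, s ≤ l → t ≤ l → F t ≤ F s + ((s - t) + (t - s)))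
    {s t : ℝ} (hs0 : 0 ≤ s) (ht0 : 0 ≤ t)
    (hs : ENNReal.ofReal s ≤ l) (ht : ENNReal.ofReal t ≤ l) (hfs : F (ENNReal.ofReal s) ≠ ⊤) :
    (F (ENNReal.ofReal t)).toReal ≤ (F (ENNReal.ofReal s)).toReal + |t - s| := by
  have h := hF _ _ hs ht
  rw [← ENNReal.ofReal_sub _ hs0, ← ENNReal.ofReal_sub _ ht0, ← ENNReal.ofReal_toReal hfs] at h
  have h2 : ENNReal.ofReal (s - t) + ENNReal.ofReal (t - s) = ENNReal.ofReal |t - s| := by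
    rcases le_total s t with hst | hst
    · rw [ENNReal.ofReal_of_nonpos (sub_nonpos.2 hst), zero_add, abs_of_nonneg (sub_nonneg.2 hst)]
    · rw [ENNReal.ofReal_of_nonpos (sub_nonpos.2 hst), add_zero, abs_of_nonpos (sub_nonpos.2 hst),
        neg_sub]
  rw [h2, ← ENNReal.ofReal_add ENNReal.toReal_nonneg (abs_nonneg _)] at h
  have h3 := ENNReal.toReal_mono ENNReal.ofReal_ne_top h
  rwa [ENNReal.toReal_ofReal (add_nonneg ENNReal.toReal_nonneg (abs_nonneg _))] at h3

/-- Along an edge, the distance to a finite point is piecewise affine with slopes `±1`. -/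
theorem exists_dist_slopes {x : G.Point} (hx : x ∈ G.finitePoints) (e : G.E) :
    ∃ P : Set (Set ℝ), P.Finite ∧ params e ⊆ ⋃₀ P ∧ ∀ I ∈ P, I.OrdConnected ∧
      ∃ (a : ℤ) (b : ℝ), (a = 1 ∨ a = -1) ∧ ∀ t ∈ I ∩ params e,
        (G.dist x (G.edge e (ENNReal.ofReal t))).toReal = a * t + b := by
  set d : ℝ → ℝ := fun t => (G.dist x (G.edge e (ENNReal.ofReal t))).toReal with hd
  have hlip : ∀ s ∈ params e, ∀ t ∈ params e, d t ≤ d s + |t - s| := fun s hs t ht =>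
    abs_toReal_sub_le (F := fun t => G.dist x (G.edge e t)) (dist_edge_le x e) hs.1 ht.1 hs.2 ht.2
      (dist_ne_top hx (edge_ofReal_mem_finitePoints hs))
  obtain ⟨C, hC, hC1, hCd⟩ : ∃ C : Set (ℤ × ℝ), C.Finite ∧ (∀ c ∈ C, c.1 = 1 ∨ c.1 = -1) ∧
      ∀ t ∈ params e, ∃ c ∈ C, d t = c.1 * t + c.2 := by
    -- `s₀` is the parameter of `x` if `x` is inside `e`, and a dummy value otherwise. The four
    -- affine functions below come from the three cases of `dist_edge_cases`, the last of which
    -- splits by sign.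
    obtain ⟨s₀, hs₀⟩ : ∃ s₀ : ℝ, ∀ s h h', x = .inner e s h h' → s₀ = s.toReal := by
      by_cases h : ∃ s h h', x = .inner e s h h'
      · obtain ⟨s, h, h', rfl⟩ := h
        refine ⟨s.toReal, fun _ _ _ heq => ?_⟩
        cases heq
        rfl
      · exact ⟨0, fun s h1 h2 h3 => (h ⟨s, h1, h2, h3⟩).elim⟩
    refine ⟨{(1, (G.dist x (.vertex (G.src e))).toReal),
      (-1, (G.dist x (.vertex (G.tgt e))).toReal + (G.len e).toReal), (1, -s₀), (-1, s₀)},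
      Set.toFinite _, by simp, fun t ht => ?_⟩
    have hfin := dist_ne_top hx (edge_ofReal_mem_finitePoints ht)
    rcases dist_edge_cases x e (ENNReal.ofReal t) ht.2 with h | h | ⟨s, h1, h2, hxs, h⟩
    · refine ⟨_, Or.inl rfl, ?_⟩
      simp only [hd, h]
      rw [h] at hfin
      rw [ENNReal.toReal_add (ENNReal.add_ne_top.1 hfin).1 (ENNReal.add_ne_top.1 hfin).2,
        ENNReal.toReal_ofReal ht.1]
      push_cast
      ring
    · refine ⟨_, Or.inr (Or.inl rfl), ?_⟩
      simp only [hd, h]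
      rw [h] at hfin
      have hlen : G.len e ≠ ⊤ := fun hl => (ENNReal.add_ne_top.1 hfin).2 (by simp [hl])
      rw [ENNReal.toReal_add (ENNReal.add_ne_top.1 hfin).1 (ENNReal.add_ne_top.1 hfin).2,
        ENNReal.toReal_sub_of_le ht.2 hlen, ENNReal.toReal_ofReal ht.1]
      push_cast
      ring
    · have hs : s ≠ ⊤ := (h2.trans_le le_top).ne
      have h0 := hs₀ s h1 h2 hxs
      have hss : s = ENNReal.ofReal s₀ := by rw [h0, ENNReal.ofReal_toReal hs]
      have hs0 : 0 ≤ s₀ := h0 ▸ ENNReal.toReal_nonneg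
      rw [hss, ← ENNReal.ofReal_sub _ ht.1, ← ENNReal.ofReal_sub _ hs0] at h
      rcases le_total s₀ t with hst | hst
      · refine ⟨(1, -s₀), by simp, ?_⟩
        simp only [hd, h]
        rw [ENNReal.ofReal_of_nonpos (sub_nonpos.2 hst), zero_add,
          ENNReal.toReal_ofReal (sub_nonneg.2 hst)]
        push_cast
        ring
      · refine ⟨(-1, s₀), by simp, ?_⟩
        simp only [hd, h]
        rw [ENNReal.ofReal_of_nonpos (sub_nonpos.2 hst), add_zero,
          ENNReal.toReal_ofReal (sub_nonneg.2 hst)]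
        push_cast
        ring
  -- The pieces are the sets where `d` agrees with one candidate. They are intervals: a 1-Lipschitz
  -- function agreeing at two points with an affine function of slope `±1` has no room to deviate in
  -- between.
  refine ⟨(fun c : ℤ × ℝ => {t ∈ params e | d t = c.1 * t + c.2}) '' C, hC.image _, ?_, ?_⟩
  · intro t ht
    obtain ⟨c, hc, h⟩ := hCd t ht
    exact ⟨_, ⟨c, hc, rfl⟩, ht, h⟩
  · rintro _ ⟨c, hc, rfl⟩
    refine ⟨⟨?_⟩, c.1, c.2, hC1 c hc, fun t ht => ht.1.2⟩
    rintro s ⟨hs, hs'⟩ t ⟨ht, ht'⟩ u hu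
    have hue := (ordConnected_params e).out hs ht hu
    refine ⟨hue, ?_⟩
    have h1 := hlip s hs u hue
    have h2 := hlip u hue t ht
    have h3 := hlip u hue s hs
    have h4 := hlip t ht u hue
    have h5 := hu.1
    have h6 := hu.2
    rw [abs_of_nonneg (by linarith)] at h1 h2
    rw [abs_of_nonpos (by linarith)] at h3 h4
    rcases hC1 c hc with h | h <;> rw [h] at hs' ht' ⊢ <;> push_cast at * <;> linarith

theorem isRational_neg_dist {x : G.Point} (hx : x ∈ G.finitePoints) :
    G.IsRational (fun y => -((G.dist x y : ℝ≥0∞) : EReal)) := by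
  refine isRational_neg_coe (fun y hy => dist_ne_top hx hy) (fun e t ht => ?_) (fun e => ?_)
  · rcases eq_or_ne t ⊤ with rfl | htop
    · have he : G.len e = ⊤ := top_le_iff.1 ht.2
      have hxe : x ≠ G.edge e ⊤ := fun h => hx ⟨e, he, h⟩
      -- The Lipschitz bound for `rayDist e 0` makes this a lower bound for the distance, and it
      -- tends to `⊤`.
      have h1 : Filter.Tendsto (fun s : ℝ≥0∞ => s - rayDist e 0 x)
          (𝓝[Set.Icc 0 (G.len e)] ⊤) (𝓝 (G.dist x (G.edge e ⊤))) := by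
        rw [dist_edge_top he hxe]
        have := ENNReal.Tendsto.sub (Filter.tendsto_id (x := 𝓝 (⊤ : ℝ≥0∞)))
          (tendsto_const_nhds (x := rayDist e 0 x)) (Or.inr (rayDist_ne_top he 0 hx))
        rw [ENNReal.top_sub (rayDist_ne_top he 0 hx)] at this
        exact this.mono_left nhdsWithin_le_nhds
      refine tendsto_of_tendsto_of_tendsto_of_le_of_le' h1 tendsto_const_nhds ?_ ?_
      · filter_upwards [self_mem_nhdsWithin] with s hs
        have := le_add_dist (rayDist_lipschitz he 0) x (G.edge e s)
        rw [rayDist_edge he 0 hs.2, if_pos rfl, tsub_zero, add_comm] at this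
        exact tsub_le_iff_right.2 this
      · refine Filter.Eventually.of_forall fun _ => ?_
        simp only [dist_edge_top he hxe, le_top]
    · exact continuousWithinAt_of_lipschitz (F := fun t => G.dist x (G.edge e t))
        (dist_edge_le x e) ht.2 htop
  · obtain ⟨P, hP, hPD, hPa⟩ := exists_dist_slopes hx e
    refine ⟨P, hP, hPD, fun I hI => ?_⟩
    obtain ⟨hIo, a, b, -, hab⟩ := hPa I hI
    refine ⟨hIo, a, b, fun t ht => ?_⟩
    rw [← hab t ht, ← EReal.toReal_coe_ennreal, EReal.coe_toReal]
    · simpa using dist_ne_top hx (edge_ofReal_mem_finitePoints ht.2)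
    · simp

/-! ### Inverses and real constants in the function semifield -/

namespace Rat

/-- Minus the distance to a finite point, as a rational function. -/
noncomputable def negDist (x : G.Point) (hx : x ∈ G.finitePoints) : G.Rat :=
  ⟨_, isRational_neg_dist hx⟩

theorem negDist_apply (x : G.Point) (hx : x ∈ G.finitePoints) (y : G.Point) :
    negDist x hx y = -((G.dist x y : ℝ≥0∞) : EReal) := rfl

/-- Minus the distance to the complement of a ray, as a rational function. -/
noncomputable def negRayDist (e : G.E) (he : G.len e = ⊤) (t : ℝ≥0∞) (ht : t ≠ ⊤) : G.Rat :=
  ⟨_, isRational_neg_rayDist he ht⟩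

theorem negRayDist_apply (e : G.E) (he : G.len e = ⊤) (t : ℝ≥0∞) (ht : t ≠ ⊤) (y : G.Point) :
    negRayDist e he t ht y = -((rayDist e t y : ℝ≥0∞) : EReal) := rfl

theorem eq_zero_or (f : G.Rat) : f = 0 ∨ ((∀ x ∈ G.finitePoints, f x ≠ ⊥ ∧ f x ≠ ⊤) ∧
    ∀ e, IsPiecewiseAffineOn (fun t => f (G.edge e (ENNReal.ofReal t))) (params e)) := by
  obtain ⟨f, hf, h | h⟩ := f
  · exact Or.inl (Subtype.ext (funext h))
  · exact Or.inr h

theorem ne_bot_and_ne_top {f : G.Rat} (hf : f ≠ 0) {x : G.Point} (hx : x ∈ G.finitePoints) :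
    f x ≠ ⊥ ∧ f x ≠ ⊤ := ((eq_zero_or f).resolve_left hf).1 x hx

theorem coe_toReal_apply {f : G.Rat} (hf : f ≠ 0) {x : G.Point} (hx : x ∈ G.finitePoints) :
    ((f x).toReal : EReal) = f x :=
  EReal.coe_toReal (ne_bot_and_ne_top hf hx).2 (ne_bot_and_ne_top hf hx).1

theorem isPiecewiseAffineOn {f : G.Rat} (hf : f ≠ 0) (e : G.E) :
    IsPiecewiseAffineOn (fun t => f (G.edge e (ENNReal.ofReal t))) (params e) :=
  ((eq_zero_or f).resolve_left hf).2 e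

theorem exists_neg {f : G.Rat} (hf : f ≠ 0) :
    ∃ g : G.Rat, (∀ x, g x = -f x) ∧ f * g = 1 := by
  have hr : G.IsRational (fun x => -f x) := by
    refine ⟨f.2.1.neg, Or.inr ⟨fun x hx => ?_, fun e => (isPiecewiseAffineOn hf e).neg⟩⟩
    have := ne_bot_and_ne_top hf hx
    simp [EReal.neg_eq_bot_iff, EReal.neg_eq_top_iff, this]
  obtain ⟨g, hg⟩ : ∃ g : G.Rat, ∀ x, g x = -f x := ⟨⟨_, hr⟩, fun _ => rfl⟩
  refine ⟨g, hg, ext_finite fun x hx => ?_⟩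
  have := ne_bot_and_ne_top hf hx
  rw [mul_apply _ _ hx, one_apply, hg, ← sub_eq_add_neg, EReal.sub_self this.2 this.1]

/-- The product is known pointwise only at finite points; uniqueness of inverses gives the formula
at infinity as well. -/
theorem apply_of_mul_eq_one {f g : G.Rat} (hf : f ≠ 0) (h : f * g = 1) (x : G.Point) :
    g x = -f x := by
  obtain ⟨g', hg', h'⟩ := exists_neg hf
  have : g = g' := by
    calc g = g * (f * g') := by rw [h', mul_one]
      _ = (f * g) * g' := by ring
      _ = g' := by rw [h, one_mul]
  rw [this, hg']

/-- The constant function with a real value. -/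
noncomputable def ofReal (c : ℝ) : G.Rat := algebraMap TropicalReal G.Rat (TropicalReal.ofReal c)

theorem ofReal_apply (c : ℝ) (x : G.Point) : (ofReal c : G.Rat) x = c := rfl

theorem continuous_add_coe (c : ℝ) : Continuous fun y : EReal => y + c := by
  refine continuous_iff_continuousAt.2 fun y => ?_
  exact ContinuousAt.comp (f := fun y : EReal => (y, (c : EReal)))
    (EReal.continuousAt_add (Or.inr (EReal.coe_ne_bot c)) (Or.inr (EReal.coe_ne_top c)))
    (by fun_prop)

/-- Adding a real number is continuous on the extended reals, so for a constant factor the product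
formula persists at infinity. -/
theorem mul_ofReal_apply (f : G.Rat) (c : ℝ) (x : G.Point) :
    (f * ofReal c : G.Rat) x = f x + c := by
  rcases eq_or_ne f 0 with rfl | hf
  · simp [zero_apply]
  have hr : G.IsRational (fun x => f x + c) := by
    refine ⟨(continuous_add_coe c).comp f.2.1, Or.inr ⟨fun x hx => ?_, fun e => ?_⟩⟩
    · change f x + c ≠ ⊥ ∧ f x + c ≠ ⊤
      rw [← coe_toReal_apply hf hx, ← EReal.coe_add]
      exact ⟨EReal.coe_ne_bot _, EReal.coe_ne_top _⟩
    · exact (isPiecewiseAffineOn hf e).add (.const c) fun _ _ => rfl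
  obtain ⟨g, hg⟩ : ∃ g : G.Rat, ∀ x, g x = f x + c := ⟨⟨_, hr⟩, fun _ => rfl⟩
  have : f * ofReal c = g := ext_finite fun x hx => by
    rw [mul_apply _ _ hx, hg, ofReal_apply]
  rw [this, hg]

theorem ofReal_ne_zero [Nonempty G.Point] (c : ℝ) : (ofReal c : G.Rat) ≠ 0 := by
  intro h
  obtain ⟨x⟩ := ‹Nonempty G.Point›
  have := congrArg (fun f : G.Rat => f x) h
  exact EReal.coe_ne_bot c this

end Rat

/-! ### Compactness and separation -/

instance : Nonempty G.Point := ⟨.vertex (Classical.arbitrary _)⟩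

instance : CompactSpace G.Point := by
  refine ⟨?_⟩
  -- The vertices are listed separately because the graph may have no edges.
  have h : (Set.univ : Set G.Point) =
      (⋃ e, G.edge e '' Set.Icc 0 (G.len e)) ∪ Set.range Point.vertex := by
    refine (Set.eq_univ_of_forall fun x => ?_).symm
    cases x with
    | vertex v => exact Or.inr ⟨v, rfl⟩
    | inner e t h h' =>
      exact Or.inl (Set.mem_iUnion.2 ⟨e, t, ⟨zero_le, h'.le⟩, edge_inner e t h h'⟩)
  rw [h]
  exact (isCompact_iUnion fun e => isCompact_Icc.image_of_continuousOn (continuousOn_edge e)).union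
    (Set.finite_range _).isCompact

theorem exists_finitePoint : ∃ x, x ∈ G.finitePoints := by
  by_cases h : Nonempty G.E
  · exact ⟨_, src_mem_finitePoints h.some⟩
  · exact ⟨.vertex (Classical.arbitrary _), fun ⟨e, _⟩ => h ⟨e⟩⟩

theorem rayDist_edge_top {e : G.E} (he : G.len e = ⊤) {t : ℝ≥0∞} (ht : t ≠ ⊤) :
    rayDist e t (G.edge e ⊤) = ⊤ := by
  classical
  rw [rayDist_edge he t (he ▸ le_rfl), if_pos rfl, ENNReal.top_sub ht]

theorem rayDist_eq_top_iff {e : G.E} (he : G.len e = ⊤) {t : ℝ≥0∞} (ht : t ≠ ⊤) {x : G.Point} :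
    rayDist e t x = ⊤ ↔ x = G.edge e ⊤ := by
  refine ⟨fun h => ?_, fun h => h ▸ rayDist_edge_top he ht⟩
  by_contra hx
  cases x with
  | vertex v =>
    simp only [rayDist] at h
    rw [if_neg] at h
    · simp at h
    · rintro rfl
      exact hx (edge_top he).symm
  | inner e' s h1 h2 => exact rayDist_ne_top he t (inner_mem_finitePoints h1 h2) h

/-- Rational functions separate points. -/
theorem exists_rat_ne {x y : G.Point} (hxy : x ≠ y) : ∃ f : G.Rat, f x ≠ f y := by
  by_cases hx : x ∈ G.finitePoints
  · refine ⟨Rat.negDist x hx, fun h => hxy (eq_of_dist_eq_zero ?_)⟩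
    rw [Rat.negDist_apply, Rat.negDist_apply, dist_self] at h
    simpa using h.symm
  · obtain ⟨e, he, rfl⟩ := not_not.1 hx
    refine ⟨Rat.negRayDist e he 0 ENNReal.zero_ne_top, fun h => hxy ?_⟩
    rw [Rat.negRayDist_apply, Rat.negRayDist_apply, rayDist_edge_top he ENNReal.zero_ne_top] at h
    have h2 : rayDist e 0 y = ⊤ := by simpa using h.symm
    exact ((rayDist_eq_top_iff he ENNReal.zero_ne_top).1 h2).symm

instance : T2Space G.Point := by
  refine ⟨fun x y hxy => ?_⟩
  obtain ⟨f, hf⟩ := exists_rat_ne hxy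
  exact separated_by_continuous f.2.1 hf

theorem dense_finitePoints : Dense G.finitePoints := by
  intro x
  by_cases hx : x ∈ G.finitePoints
  · exact subset_closure hx
  obtain ⟨e, he, rfl⟩ := not_not.1 hx
  have hc : Continuous (G.edge e) := by
    have := continuousOn_edge e
    rwa [he, show Set.Icc (0 : ℝ≥0∞) ⊤ = Set.univ by ext; simp, continuousOn_univ] at this
  refine closure_mono ?_ (image_closure_subset_closure_image hc
    ⟨⊤, dense_compl_singleton (⊤ : ℝ≥0∞) ⊤, rfl⟩)
  rintro _ ⟨t, ht, rfl⟩
  exact edge_mem_finitePoints (he ▸ le_top) ht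

end EdgeWeightedGraph

/-! ### Auxiliary facts on real functions and finite covers -/

/-- A continuous function on an interval which is `K`-Lipschitz on each of finitely many pieces
is `K`-Lipschitz. -/
theorem abs_sub_le_of_finite_pieces {g : ℝ → ℝ} {D : Set ℝ} (hD : D.OrdConnected)
    (hg : ContinuousOn g D) {P : Set (Set ℝ)} (hP : P.Finite) (hPD : D ⊆ ⋃₀ P) {K : ℝ}
    (hK : ∀ I ∈ P, ∀ s ∈ I ∩ D, ∀ t ∈ I ∩ D, |g t - g s| ≤ K * |t - s|) :
    ∀ s ∈ D, ∀ t ∈ D, |g t - g s| ≤ K * |t - s| := by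
  suffices h : ∀ s ∈ D, ∀ t ∈ D, s ≤ t → |g t - g s| ≤ K * (t - s) by
    intro s hs t ht
    rcases le_total s t with hst | hst
    · rw [abs_of_nonneg (sub_nonneg.2 hst)]
      exact h s hs t ht hst
    · rw [abs_sub_comm, abs_sub_comm t s, abs_of_nonneg (sub_nonneg.2 hst)]
      exact h t ht s hs hst
  intro s hs t ht hst
  have hsub : Set.Icc s t ⊆ D := hD.out hs ht
  have hgst := hg.mono hsub
  -- Continuous induction: the set where the bound from `s` holds is closed, and it remains to
  -- advance a little beyond any of its points `x < t`.
  have hcl : IsClosed ({u | |g u - g s| ≤ K * (u - s)} ∩ Set.Icc s t) := by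
    have := isClosed_Icc.isClosed_le (f := fun u => |g u - g s|) (g := fun u => K * (u - s))
      (hgst.sub continuousOn_const).abs (by fun_prop)
    convert this using 1
    ext u
    exact and_comm
  refine hcl.Icc_subset_of_forall_exists_gt (by simp) ?_ ⟨hst, le_rfl⟩
  rintro x ⟨hx, hxs, hxt⟩ y hy
  have hy' : (x : ℝ) < min y t := lt_min hy hxt
  have hev : ∀ᶠ u in 𝓝[>] x, u ∈ Set.Ioo x (min y t) := Ioo_mem_nhdsGT hy'
  obtain ⟨I, hI, hfr⟩ : ∃ I ∈ P, ∃ᶠ u in 𝓝[>] x, u ∈ I := by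
    by_contra hcon
    simp only [not_exists, not_and, Filter.not_frequently] at hcon
    obtain ⟨u, hu, hu'⟩ := (((Filter.eventually_all_finite hP).2 hcon).and hev).exists
    obtain ⟨I, hI, huI⟩ := hPD (hsub ⟨hxs.trans hu'.1.le, hu'.2.le.trans (min_le_right _ _)⟩)
    exact hu I hI huI
  obtain ⟨u, huI, hu⟩ := (hfr.and_eventually hev).exists
  have hmem : ∀ v ∈ Set.Ioo x (min y t), v ∈ Set.Icc s t := fun v hv =>
    ⟨hxs.trans hv.1.le, hv.2.le.trans (min_le_right _ _)⟩
  refine ⟨u, ?_, hu.1, hu.2.le.trans (min_le_left _ _)⟩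
  have hcx : Filter.Tendsto g (𝓝[>] x) (𝓝 (g x)) := by
    have h1 : ContinuousWithinAt g (Set.Ioo x (min y t)) x :=
      (hgst x ⟨hxs, hxt.le⟩).mono hmem
    rwa [ContinuousWithinAt, nhdsWithin_Ioo_eq_nhdsGT hy'] at h1
  -- The point `x` need not belong to the piece `I`, but `I` has points arbitrarily close to the
  -- right of `x`. The bound between such points and `u` passes to the limit.
  have hux : |g u - g x| ≤ K * |u - x| := by
    have h1 : Filter.Tendsto (fun v => |g u - g v| - K * |u - v|) (𝓝[>] x)
        (𝓝 (|g u - g x| - K * |u - x|)) :=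
      (hcx.const_sub _).abs.sub (((tendsto_const_nhds.sub
        (Filter.tendsto_id.mono_left nhdsWithin_le_nhds)).abs).const_mul K)
    have h2 : |g u - g x| - K * |u - x| ≤ 0 :=
      le_of_tendsto_of_frequently h1 ((hfr.and_eventually hev).mono fun v hv =>
        sub_nonpos.2 (hK I hI v ⟨hv.1, hsub (hmem v hv.2)⟩ u ⟨huI, hsub (hmem u hu)⟩))
    linarith
  rw [abs_of_pos (sub_pos.2 hu.1)] at hux
  have := abs_sub_le (g u) (g x) (g s)
  simp only [Set.mem_ofPred_eq] at hx ⊢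
  linarith

/-- Pigeonhole. Two distinct points in a common piece suffice to compare the slopes of affine
formulas valid there. -/
theorem exists_ne_mem_of_infinite {α : Type*} {S : Set α} (hS : S.Infinite) {P : Set (Set α)}
    (hP : P.Finite) (hSP : S ⊆ ⋃₀ P) : ∃ J ∈ P, ∃ u ∈ S, ∃ v ∈ S, u ≠ v ∧ u ∈ J ∧ v ∈ J := by
  have hSP' : ∀ u ∈ S, ∃ I, I ∈ P ∧ u ∈ I := fun u hu => hSP hu
  choose! c hc using hSP'
  obtain ⟨u, hu, v, hv, huv, h⟩ :=
    hS.exists_ne_map_eq_of_mapsTo (f := c) (t := P) (fun u hu => (hc u hu).1) hP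
  exact ⟨c u, (hc u hu).1, u, hu, v, hv, huv, (hc u hu).2, h ▸ (hc v hv).2⟩

/-- Both `n * ρ a` and `n * (ρ 1 * a)` lie between `⌊n * a⌋ * ρ 1` and `(⌊n * a⌋ + 1) * ρ 1`, so
they differ by at most `ρ 1` for every `n`. -/
theorem map_eq_mul_of_strictMono (ρ : ℝ → ℝ) (hadd : ∀ a b, ρ (a + b) = ρ a + ρ b)
    (hmono : StrictMono ρ) (a : ℝ) : ρ a = ρ 1 * a := by
  let f : ℝ →+ ℝ := AddMonoidHom.mk' ρ hadd
  have hint : ∀ n : ℤ, ρ n = n * ρ 1 := fun n => by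
    have h := map_zsmul f n 1
    rw [zsmul_eq_mul, zsmul_eq_mul, mul_one] at h
    exact h
  have hnat : ∀ (n : ℕ) x, ρ (n * x) = n * ρ x := fun n x => by
    have h := map_nsmul f n x
    rw [nsmul_eq_mul, nsmul_eq_mul] at h
    exact h
  have h0 : ρ 0 = 0 := f.map_zero
  have h1 : 0 < ρ 1 := h0 ▸ hmono one_pos
  have key : ∀ n : ℕ, n * |ρ a - ρ 1 * a| ≤ ρ 1 := by
    intro n
    have h2 := hmono.monotone (Int.floor_le (n * a))
    have h3 := hmono (Int.lt_floor_add_one (n * a))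
    rw [hadd, hint, hnat] at h3
    rw [hint, hnat] at h2
    have h4 := mul_le_mul_of_nonneg_right (Int.floor_le (n * a)) h1.le
    have h5 := mul_lt_mul_of_pos_right (Int.lt_floor_add_one (n * a)) h1
    rw [← abs_of_nonneg (Nat.cast_nonneg (α := ℝ) n), ← abs_mul, abs_le]
    constructor <;> linarith
  by_contra hne
  have hpos : 0 < |ρ a - ρ 1 * a| := abs_pos.2 (sub_ne_zero.2 hne)
  obtain ⟨n, hn⟩ := exists_nat_gt (ρ 1 / |ρ a - ρ 1 * a|)
  rw [div_lt_iff₀ hpos] at hn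
  exact absurd (key n) (not_le.2 hn)

/-! ### Constants as the functions with roots of all orders -/

namespace EdgeWeightedGraph

variable {G : EdgeWeightedGraph}

namespace Rat

theorem continuousOn_toReal {f : G.Rat} (hf : f ≠ 0) (e : G.E) :
    ContinuousOn (fun t => (f (G.edge e (ENNReal.ofReal t))).toReal) (params e) := by
  intro t ht
  have h1 : ContinuousWithinAt (fun t => f (G.edge e (ENNReal.ofReal t))) (params e) t :=
    (continuous_iff.1 f.2.1 e _ ⟨zero_le, ht.2⟩).comp
      (ENNReal.continuous_ofReal.continuousWithinAt) fun s hs => ⟨zero_le, hs.2⟩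
  have h2 := ne_bot_and_ne_top hf (edge_ofReal_mem_finitePoints ht)
  exact (EReal.tendsto_toReal h2.2 h2.1).comp h1

theorem exists_pieces {f : G.Rat} (hf : f ≠ 0) (e : G.E) :
    ∃ P : Set (Set ℝ), P.Finite ∧ params e ⊆ ⋃₀ P ∧ ∀ I ∈ P, I.OrdConnected ∧
      ∃ (a : ℤ) (b : ℝ), ∀ t ∈ I ∩ params e,
        (f (G.edge e (ENNReal.ofReal t))).toReal = a * t + b := by
  obtain ⟨P, hP, hPD, hPa⟩ := isPiecewiseAffineOn hf e
  refine ⟨P, hP, hPD, fun I hI => ?_⟩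
  obtain ⟨hIo, a, b, hab⟩ := hPa I hI
  refine ⟨hIo, a, b, fun t ht => ?_⟩
  have := hab t ht
  simp only [this, EReal.toReal_coe]

theorem pow_apply {f : G.Rat} (hf : f ≠ 0) (n : ℕ) {x : G.Point} (hx : x ∈ G.finitePoints) :
    (f ^ n : G.Rat) x = ((n * (f x).toReal : ℝ) : EReal) := by
  induction n with
  | zero => simp [one_apply]
  | succ n ih =>
    rw [pow_succ, mul_apply _ _ hx, ih, ← coe_toReal_apply hf hx, ← EReal.coe_add]
    congr 1
    simp
    ring

/-- If the slope of a rational function with integer slopes is `K`-bounded on every nondegenerate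
piece, then the function is `K`-Lipschitz along the edge. -/
theorem abs_sub_le {f : G.Rat} (hf : f ≠ 0) (e : G.E) {K : ℝ}
    (hslope : ∀ (s t : ℝ) (a : ℤ) (b : ℝ), s < t → Set.Icc s t ⊆ params e →
      (∀ u ∈ Set.Icc s t, (f (G.edge e (ENNReal.ofReal u))).toReal = a * u + b) → |(a : ℝ)| ≤ K) :
    ∀ s ∈ params e, ∀ t ∈ params e,
      |(f (G.edge e (ENNReal.ofReal t))).toReal - (f (G.edge e (ENNReal.ofReal s))).toReal|
        ≤ K * |t - s| := by
  obtain ⟨P, hP, hPD, hPa⟩ := exists_pieces hf e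
  refine abs_sub_le_of_finite_pieces (ordConnected_params e) (continuousOn_toReal hf e) hP hPD
    fun I hI s hs t ht => ?_
  obtain ⟨hIo, a, b, hab⟩ := hPa I hI
  have hbound : ∀ s ∈ I ∩ params e, ∀ t ∈ I ∩ params e, s < t → |(a : ℝ)| ≤ K :=
    fun s hs t ht hst => hslope s t a b hst ((ordConnected_params e).out hs.2 ht.2) fun u hu =>
      hab u ⟨hIo.out hs.1 ht.1 hu, (ordConnected_params e).out hs.2 ht.2 hu⟩
  rcases eq_or_ne s t with rfl | hst
  · simp
  have : |(a : ℝ)| ≤ K := by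
    rcases hst.lt_or_gt with h | h
    · exact hbound s hs t ht h
    · exact hbound t ht s hs h
  simp only [hab s hs, hab t ht]
  rw [add_sub_add_right_eq_sub, ← mul_sub, abs_mul]
  gcongr

/-- The rational functions that have roots of all orders are the constant ones. -/
theorem exists_eq_ofReal {f : G.Rat} (hf : f ≠ 0) (hroot : ∀ n : ℕ, 0 < n → ∃ g : G.Rat, g ^ n = f) :
    ∃ c : ℝ, f = ofReal c := by
  have hedge : ∀ e, ∀ s ∈ params e, ∀ t ∈ params e,
      (f (G.edge e (ENNReal.ofReal t))).toReal = (f (G.edge e (ENNReal.ofReal s))).toReal := by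
    intro e s hs t ht
    have := abs_sub_le (K := 0) hf e (fun s t a b hst hsub hab => ?_) s hs t ht
    · rw [zero_mul] at this
      exact sub_eq_zero.1 (abs_nonpos_iff.1 this)
    -- A root of order `|a| + 1` has an integer slope, so `a` is divisible by a number exceeding
    -- `|a|` and must vanish.
    · obtain ⟨g, hg⟩ := hroot (a.natAbs + 1) (Nat.succ_pos _)
      have hg0 : g ≠ 0 := by
        rintro rfl
        exact hf (by rw [← hg, zero_pow (Nat.succ_ne_zero _)])
      obtain ⟨P, hP, hPD, hPa⟩ := exists_pieces hg0 e
      obtain ⟨J, hJ, u, hu, v, hv, huv, huJ, hvJ⟩ :=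
        exists_ne_mem_of_infinite (Set.Icc_infinite hst) hP (hsub.trans hPD)
      obtain ⟨-, a', b', hab'⟩ := hPa J hJ
      have key : ∀ u ∈ Set.Icc s t, u ∈ J →
          ((a.natAbs + 1 : ℕ) : ℝ) * (a' * u + b') = a * u + b := fun u hu huJ => by
        rw [← hab u hu, ← hab' u ⟨huJ, hsub hu⟩, ← hg,
          pow_apply hg0 _ (edge_ofReal_mem_finitePoints (hsub hu)), EReal.toReal_coe]
      have h1 := key u hu huJ
      have h2 := key v hv hvJ
      have h3 : (((a.natAbs + 1 : ℕ) : ℝ) * a' - a) * (u - v) = 0 := by linear_combination h1 - h2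
      have h4 := sub_eq_zero.1 ((mul_eq_zero.1 h3).resolve_right (sub_ne_zero.2 huv))
      have h5 : ((a.natAbs + 1 : ℕ) : ℤ) * a' = a := by
        rw [← Int.cast_inj (α := ℝ), Int.cast_mul, Int.cast_natCast]
        exact h4
      have h6 : a = 0 := Int.eq_zero_of_abs_lt_dvd (Dvd.intro _ h5) (by simp)
      simp [h6]
  have hedge' : ∀ e, ∀ t, t ≤ G.len e → f (G.edge e t) = f (.vertex (G.src e)) := by
    intro e
    have hfin : ∀ t, t ≤ G.len e → t ≠ ⊤ → f (G.edge e t) = f (.vertex (G.src e)) := by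
      intro t ht htop
      have h0 : (0 : ℝ) ∈ params e := ⟨le_rfl, by simp⟩
      have h := hedge e 0 h0 _ (toReal_mem_params ht htop)
      rw [ENNReal.ofReal_toReal htop, ENNReal.ofReal_zero, edge_zero] at h
      rw [← coe_toReal_apply hf (edge_mem_finitePoints ht htop), h,
        coe_toReal_apply hf (src_mem_finitePoints e)]
    intro t ht
    rcases eq_or_ne t ⊤ with rfl | htop
    · have he : G.len e = ⊤ := top_le_iff.1 ht
      have hcf := continuous_iff.1 f.2.1 e
      rw [show Set.Icc (0 : ℝ≥0∞) (G.len e) = Set.univ by rw [he]; ext; simp,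
        continuousOn_univ] at hcf
      have : Set.EqOn (fun t => f (G.edge e t)) (fun _ => f (.vertex (G.src e))) {⊤}ᶜ :=
        fun t ht => hfin t (he ▸ le_top) ht
      exact congrFun (hcf.ext_on (dense_compl_singleton ⊤) continuous_const this) ⊤
    · exact hfin t ht htop
  have hvert : ∀ v w : G.V, Relation.EqvGen (fun a b => ∃ e, G.src e = a ∧ G.tgt e = b) v w →
      f (.vertex v) = f (.vertex w) := by
    intro v w h
    induction h with
    | rel a b h =>
      obtain ⟨e, rfl, rfl⟩ := h
      rw [← hedge' e _ le_rfl, edge_len]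
    | refl a => rfl
    | symm a b _ ih => exact ih.symm
    | trans a b c _ _ ih ih' => exact ih.trans ih'
  obtain ⟨x₀, hx₀⟩ := exists_finitePoint (G := G)
  have hall : ∀ x y, f x = f y := by
    have h1 : ∀ x, ∃ v, f x = f (.vertex v) := by
      intro x
      cases x with
      | vertex v => exact ⟨v, rfl⟩
      | inner e t h h' => exact ⟨G.src e, by rw [← edge_inner e t h h', hedge' e t h'.le]⟩
    intro x y
    obtain ⟨v, hv⟩ := h1 x
    obtain ⟨w, hw⟩ := h1 y
    rw [hv, hw, hvert v w (G.connected v w)]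
  refine ⟨(f x₀).toReal, ext_finite fun x _ => ?_⟩
  rw [ofReal_apply, coe_toReal_apply hf hx₀, hall]

theorem ofReal_mul_ofReal (a b : ℝ) : (ofReal a * ofReal b : G.Rat) = ofReal (a + b) := by
  rw [ofReal, ofReal, ← map_mul]
  rfl

theorem ofReal_add_ofReal (a b : ℝ) : (ofReal a + ofReal b : G.Rat) = ofReal (max a b) := by
  rw [ofReal, ofReal, ← map_add, TropicalReal.ofReal_add]
  rfl

theorem ofReal_pow (a : ℝ) (n : ℕ) : (ofReal a ^ n : G.Rat) = ofReal (n * a) :=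
  ext_finite fun x hx => by
    rw [pow_apply (ofReal_ne_zero a) n hx, ofReal_apply, ofReal_apply, EReal.toReal_coe]

theorem ofReal_injective : Function.Injective (ofReal : ℝ → G.Rat) := by
  intro a b h
  obtain ⟨x⟩ : Nonempty G.Point := inferInstance
  have := congrArg (fun f : G.Rat => f x) h
  exact EReal.coe_injective this

variable {G₁ G₂ : EdgeWeightedGraph}

/-- A semiring isomorphism scales the real constants by a positive factor. -/
theorem exists_map_ofReal (ψ : G₁.Rat ≃+* G₂.Rat) :
    ∃ r : ℝ, 0 < r ∧ ∀ c, ψ (ofReal c) = ofReal (r * c) := by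
  have h : ∀ c : ℝ, ∃ c', ψ (ofReal c) = ofReal c' := by
    intro c
    -- Having roots of all orders is preserved by `ψ`; a root of the constant `c` of order `n` is
    -- the constant `c / n`.
    refine exists_eq_ofReal ((map_ne_zero_iff ψ ψ.injective).2 (ofReal_ne_zero c)) fun n hn => ?_
    refine ⟨ψ (ofReal (c / n)), ?_⟩
    rw [← map_pow, ofReal_pow, mul_div_cancel₀]
    exact_mod_cast hn.ne'
  choose ρ hρ using h
  have hadd : ∀ a b, ρ (a + b) = ρ a + ρ b := fun a b => ofReal_injective (G := G₂) <| by
    rw [← hρ, ← ofReal_mul_ofReal, map_mul, hρ, hρ, ofReal_mul_ofReal]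
  have hmax : ∀ a b, ρ (max a b) = max (ρ a) (ρ b) := fun a b => ofReal_injective (G := G₂) <| by
    rw [← hρ, ← ofReal_add_ofReal, map_add, hρ, hρ, ofReal_add_ofReal]
  have hinj : Function.Injective ρ := fun a b h => ofReal_injective (G := G₁) <| ψ.injective <| by
    rw [hρ, hρ, h]
  have hmono : StrictMono ρ := by
    refine Monotone.strictMono_of_injective (fun a b hab => ?_) hinj
    have := hmax a b
    rw [max_eq_right hab] at this
    exact this ▸ le_max_left _ _
  have h0 : ρ 0 = 0 := by simpa using hadd 0 0
  refine ⟨ρ 1, h0 ▸ hmono one_pos, fun c => ?_⟩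
  rw [hρ, map_eq_mul_of_strictMono ρ hadd hmono]

end Rat

end EdgeWeightedGraph

/-! ### The homeomorphism underlying the isomorphism -/

namespace EdgeWeightedGraph

variable {G : EdgeWeightedGraph}

theorem continuous_coe_mul {r : ℝ} (hr : r ≠ 0) : Continuous fun y : EReal => (r : EReal) * y := by
  refine continuous_iff_continuousAt.2 fun y => ?_
  have h0 : (r : EReal) ≠ 0 := by exact_mod_cast hr
  exact ContinuousAt.comp (f := fun y : EReal => ((r : EReal), y))
    (EReal.continuousAt_mul (Or.inl h0) (Or.inl h0) (Or.inl (EReal.coe_ne_bot r))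
      (Or.inl (EReal.coe_ne_top r))) (by fun_prop)

theorem Rat.sum_apply {ι : Type*} (u : Finset ι) (g : ι → G.Rat) (x : G.Point) :
    (∑ i ∈ u, g i : G.Rat) x = u.sup fun i => g i x := by
  classical
  induction u using Finset.induction_on with
  | empty => rfl
  | insert i u hi ih =>
    rw [Finset.sum_insert hi, Finset.sup_insert, Rat.add_apply, ih]

variable {G₁ G₂ : EdgeWeightedGraph} {ψ : G₁.Rat ≃+* G₂.Rat} {r : ℝ}

/-- The function `g` is `|f - f y|`, written as a maximum of `f - f y` and its negative. This
expression uses only semifield operations and constants, so `ψ g = |ψ f - r * f y|`, also where the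
value is infinite. -/
theorem Rat.exists_le_zero_of_map_ne (hr : 0 < r)
    (hψ : ∀ c, ψ (Rat.ofReal c) = Rat.ofReal (r * c)) {y : G₁.Point} (hy : y ∈ G₁.finitePoints)
    (f : G₁.Rat) : ∃ g : G₁.Rat, g y ≤ 0 ∧ ∀ z, ψ f z ≠ (r : EReal) * f y → 0 < ψ g z := by
  rcases eq_or_ne f 0 with rfl | hf
  · refine ⟨0, by simp [Rat.zero_apply], fun z hz => (hz ?_).elim⟩
    rw [map_zero, Rat.zero_apply, Rat.zero_apply, EReal.coe_mul_bot_of_pos hr]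
  obtain ⟨f', hf', hff'⟩ := Rat.exists_neg hf
  have hψf : ψ f ≠ 0 := (map_ne_zero_iff ψ ψ.injective).2 hf
  have hψf' := Rat.apply_of_mul_eq_one hψf (by rw [← map_mul, hff', map_one])
  obtain ⟨c, hc⟩ : ∃ c : ℝ, f y = c := ⟨_, (Rat.coe_toReal_apply hf hy).symm⟩
  refine ⟨f * Rat.ofReal (-c) + f' * Rat.ofReal c, ?_, fun z hz => ?_⟩
  · rw [Rat.add_apply, Rat.mul_ofReal_apply, Rat.mul_ofReal_apply, hf', hc, ← EReal.coe_neg,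
      ← EReal.coe_add, ← EReal.coe_add]
    simp
  · rw [map_add, map_mul, map_mul, hψ, hψ, Rat.add_apply, Rat.mul_ofReal_apply,
      Rat.mul_ofReal_apply, hψf']
    rw [hc, ← EReal.coe_mul] at hz
    generalize ψ f z = w at hz
    induction w with
    | bot => rw [EReal.neg_bot, EReal.top_add_coe]; simp
    | top => rw [EReal.top_add_coe]; simp
    | coe w =>
      have hne : w ≠ r * c := fun h => hz (by rw [h])
      rw [← EReal.coe_neg, ← EReal.coe_add, ← EReal.coe_add, lt_max_iff]
      rcases hne.lt_or_gt with h | h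
      · right
        exact_mod_cast (by linarith : 0 < -w + r * c)
      · left
        exact_mod_cast (by linarith : 0 < w + r * -c)

/-- A Nullstellensatz by compactness. Finitely many incompatible conditions would produce a function
that is nonpositive at `y` but has a strictly positive image under `ψ`. -/
theorem exists_map_apply_eq_of_finite (hr : 0 < r)
    (hψ : ∀ c, ψ (Rat.ofReal c) = Rat.ofReal (r * c)) {y : G₁.Point} (hy : y ∈ G₁.finitePoints) :
    ∃ z : G₂.Point, ∀ f, ψ f z = (r : EReal) * f y := by
  by_contra hcon
  obtain ⟨u, hu⟩ := isCompact_univ.elim_finite_subfamily_closed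
    (fun f : G₁.Rat => {z : G₂.Point | ψ f z = (r : EReal) * f y})
    (fun f => isClosed_eq (ψ f).2.1 continuous_const) (by
      rw [Set.univ_inter, Set.eq_empty_iff_forall_notMem]
      exact fun z hz => hcon ⟨z, fun f => Set.mem_iInter.1 hz f⟩)
  choose g hgy hg using Rat.exists_le_zero_of_map_ne hr hψ hy
  have hpos : ∀ z, 0 < ψ (∑ f ∈ u, g f) z := by
    intro z
    rw [map_sum, Rat.sum_apply, Finset.lt_sup_iff]
    by_contra! h
    refine Set.eq_empty_iff_forall_notMem.1 hu z ⟨trivial, Set.mem_iInter₂.2 fun f hf => ?_⟩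
    by_contra hne
    exact not_le.2 (hg f z hne) (h f hf)
  obtain ⟨z₀, -, hz₀⟩ := isCompact_univ.exists_isMinOn Set.univ_nonempty
    (ψ (∑ f ∈ u, g f)).2.1.continuousOn
  -- The minimum of the image is positive but possibly `⊤`, so a real `ε` strictly below it is
  -- chosen. The image absorbs the constant `ε`, and pulling this equation back, the original
  -- function absorbs `ε / r > 0`.
  obtain ⟨ε, hε0, hε⟩ := EReal.lt_iff_exists_real_btwn.1 (hpos z₀)
  have h1 : ψ (∑ f ∈ u, g f) + Rat.ofReal (r * (ε / r)) = ψ (∑ f ∈ u, g f) := by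
    refine Rat.ext_finite fun z _ => ?_
    rw [Rat.add_apply, Rat.ofReal_apply, mul_div_cancel₀ _ hr.ne']
    exact max_eq_left (hε.le.trans (hz₀ (Set.mem_univ z)))
  rw [← hψ, ← map_add] at h1
  have h2 := congrArg (fun f : G₁.Rat => f y) (ψ.injective h1)
  simp only [Rat.add_apply, Rat.ofReal_apply] at h2
  have h3 : (∑ f ∈ u, g f : G₁.Rat) y ≤ 0 := by
    rw [Rat.sum_apply]
    exact Finset.sup_le fun f _ => hgy f
  have h4 := (max_eq_left_iff.1 h2).trans h3
  have h5 : ε / r ≤ 0 := by exact_mod_cast h4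
  have h6 : 0 < ε := by exact_mod_cast hε0
  exact absurd h5 (not_le.2 (div_pos h6 hr))

theorem isClosed_correspondence (hr : 0 < r) :
    IsClosed {p : G₁.Point × G₂.Point | ∀ f, ψ f p.2 = (r : EReal) * f p.1} := by
  simp only [Set.ofPred_forall]
  exact isClosed_iInter fun f => isClosed_eq ((ψ f).2.1.comp continuous_snd)
    ((continuous_coe_mul hr.ne').comp (f.2.1.comp continuous_fst))

/-- The points `y` admitting such a `z` are the projection of a closed set along a compact factor.
They form a closed set containing the dense set of finite points. -/
theorem exists_map_apply_eq (hr : 0 < r)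
    (hψ : ∀ c, ψ (Rat.ofReal c) = Rat.ofReal (r * c)) (y : G₁.Point) :
    ∃ z : G₂.Point, ∀ f, ψ f z = (r : EReal) * f y := by
  have hcl := isClosedMap_fst_of_compactSpace _ (isClosed_correspondence (ψ := ψ) hr)
  have hsub : closure G₁.finitePoints ⊆ _ := closure_minimal (fun x hx => by
    obtain ⟨z, hz⟩ := exists_map_apply_eq_of_finite hr hψ hx
    exact ⟨(x, z), hz, rfl⟩) hcl
  obtain ⟨⟨y', z⟩, h, rfl⟩ := hsub (dense_finitePoints y)
  exact ⟨z, h⟩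

theorem eq_of_map_apply_eq {y : G₁.Point} {z z' : G₂.Point}
    (hz : ∀ f, ψ f z = (r : EReal) * f y) (hz' : ∀ f, ψ f z' = (r : EReal) * f y) : z = z' := by
  by_contra hne
  obtain ⟨g, hg⟩ := exists_rat_ne hne
  apply hg
  rw [← ψ.apply_symm_apply g, hz, hz']

theorem symm_apply_eq (hr : 0 < r) {y : G₁.Point} {z : G₂.Point}
    (hz : ∀ f, ψ f z = (r : EReal) * f y) (g : G₂.Rat) :
    ψ.symm g y = ((r⁻¹ : ℝ) : EReal) * g z := by
  have := hz (ψ.symm g)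
  rw [ψ.apply_symm_apply] at this
  rw [this, ← mul_assoc, ← EReal.coe_mul, inv_mul_cancel₀ hr.ne', EReal.coe_one, one_mul]

theorem symm_map_ofReal (hr : 0 < r) (hψ : ∀ c, ψ (Rat.ofReal c) = Rat.ofReal (r * c)) (c : ℝ) :
    ψ.symm (Rat.ofReal c) = Rat.ofReal (r⁻¹ * c) := by
  rw [RingEquiv.symm_apply_eq, hψ, mul_inv_cancel_left₀ hr.ne']

/-- The homeomorphism of the curves underlying an isomorphism of the rational function
semifields. -/
theorem exists_homeomorph (hr : 0 < r) (hψ : ∀ c, ψ (Rat.ofReal c) = Rat.ofReal (r * c)) :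
    ∃ φ : G₁.Point ≃ₜ G₂.Point, ∀ f x, ψ f (φ x) = (r : EReal) * f x := by
  choose φ hφ using exists_map_apply_eq hr hψ
  choose χ hχ using exists_map_apply_eq (ψ := ψ.symm) (inv_pos.2 hr) (symm_map_ofReal hr hψ)
  -- Closed graph argument: the preimage of `C` is the projection of a closed part of the
  -- correspondence, whose fibres are singletons by `eq_of_map_apply_eq`.
  have hcont : Continuous φ := by
    refine continuous_iff_isClosed.2 fun C hC => ?_
    have hcl := isClosedMap_fst_of_compactSpace _
      ((isClosed_correspondence (ψ := ψ) hr).inter (hC.preimage continuous_snd))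
    convert hcl using 1
    ext x
    constructor
    · exact fun hx => ⟨(x, φ x), ⟨hφ x, hx⟩, rfl⟩
    · rintro ⟨⟨x, z⟩, ⟨h, hz⟩, rfl⟩
      rwa [Set.mem_preimage, eq_of_map_apply_eq (hφ x) h]
  have h1 : Function.LeftInverse χ φ := fun x =>
    eq_of_map_apply_eq (ψ := ψ.symm) (hχ (φ x)) (symm_apply_eq hr (hφ x))
  have h2 : Function.RightInverse χ φ := fun z => by
    refine eq_of_map_apply_eq (hφ (χ z)) fun f => ?_
    have := symm_apply_eq (inv_pos.2 hr) (hχ z) f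
    rwa [inv_inv] at this
  exact ⟨hcont.homeoOfEquivCompactToT2 (f := ⟨φ, χ, h1, h2⟩), fun f x => hφ x f⟩

/-! ### Finite points and distances under the homeomorphism -/

theorem Rat.negDist_ne_zero (x : G.Point) (hx : x ∈ G.finitePoints) : negDist x hx ≠ 0 := by
  intro h
  have := congrArg (fun f : G.Rat => f x) h
  simp only [negDist_apply, dist_self, zero_apply] at this
  simp at this

/-- Minus the distance to a finite point is `-∞` at every point at infinity, whereas a nonzero
rational function is real at the finite point `x`. -/
theorem map_mem_finitePoints {x : G₁.Point} {z : G₂.Point}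
    (hz : ∀ f, ψ f z = (r : EReal) * f x) (hx : x ∈ G₁.finitePoints) : z ∈ G₂.finitePoints := by
  by_contra hz'
  obtain ⟨y, hy⟩ := exists_finitePoint (G := G₂)
  have hyz : y ≠ z := fun h => hz' (h ▸ hy)
  have h1 : Rat.negDist y hy z = ⊥ := by
    rw [Rat.negDist_apply, dist_of_mem_infinitePoints (not_not.1 hz') hyz]
    rfl
  have hne : ψ.symm (Rat.negDist y hy) ≠ 0 :=
    (map_ne_zero_iff _ ψ.symm.injective).2 (Rat.negDist_ne_zero y hy)
  have h2 := hz (ψ.symm (Rat.negDist y hy))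
  rw [ψ.apply_symm_apply, h1, ← Rat.coe_toReal_apply hne hx, ← EReal.coe_mul] at h2
  exact EReal.coe_ne_bot _ h2.symm

theorem subsingleton_of_isEmpty [IsEmpty G.E] : Subsingleton G.Point := by
  have hV : ∀ v w : G.V, Relation.EqvGen (fun a b => ∃ e, G.src e = a ∧ G.tgt e = b) v w →
      v = w := by
    intro v w h
    induction h with
    | rel a b h => exact isEmptyElim h.choose
    | refl a => rfl
    | symm a b _ ih => exact ih.symm
    | trans a b c _ _ ih ih' => exact ih.trans ih'
  refine ⟨fun x y => ?_⟩
  cases x with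
  | inner e t h h' => exact (IsEmpty.false e).elim
  | vertex v =>
    cases y with
    | inner e t h h' => exact (IsEmpty.false e).elim
    | vertex w => rw [hV v w (G.connected v w)]

theorem exists_edge_ofReal_eq [Nonempty G.E] {x : G.Point} (hx : x ∈ G.finitePoints) :
    ∃ e, ∃ t ∈ params e, G.edge e (ENNReal.ofReal t) = x := by
  obtain ⟨e, t, ht, rfl⟩ := exists_edge_eq x
  have htop : t ≠ ⊤ := by
    rintro rfl
    exact hx ⟨e, top_le_iff.1 ht, rfl⟩
  exact ⟨e, t.toReal, toReal_mem_params ht htop, by rw [ENNReal.ofReal_toReal htop]⟩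

theorem Rat.toReal_negDist_apply (x : G.Point) (hx : x ∈ G.finitePoints) (y : G.Point) :
    (negDist x hx y).toReal = -(G.dist x y).toReal := by
  rw [negDist_apply, EReal.toReal_neg_eq, EReal.toReal_coe_ennreal]

/-- Integrality is used in both curves. On a small piece `φ` stretches parameters by `±r * a`, read
off from the pullback of minus the distance to `φ x`. The image of minus the distance to `x` then
has slope `k` with `a * k = ±1`. As `k` is an integer too, `a` is a unit. -/
theorem abs_slope_le_one (hr : 0 < r) {φ : G₁.Point → G₂.Point}
    (hφ : ∀ f x, ψ f (φ x) = (r : EReal) * f x) (hinj : Function.Injective φ) {x : G₁.Point}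
    (hx : x ∈ G₁.finitePoints) (e : G₁.E) {s t : ℝ} {a : ℤ} {b : ℝ} (hst : s < t)
    (hsub : Set.Icc s t ⊆ params e)
    (hab : ∀ u ∈ Set.Icc s t, (ψ.symm (Rat.negDist (φ x) (map_mem_finitePoints
      (fun f => hφ f x) hx)) (G₁.edge e (ENNReal.ofReal u))).toReal = a * u + b) :
    |(a : ℝ)| ≤ 1 := by
  have hφx : φ x ∈ G₂.finitePoints := map_mem_finitePoints (fun f => hφ f x) hx
  obtain ⟨Q, hQ, hQD, hQa⟩ := exists_dist_slopes hx e
  -- Without edges the target is a point. But the distance to `x` has slope `±1` on pieces of the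
  -- segment, which therefore contains two distinct points, against injectivity.
  have hne : Nonempty G₂.E := by
    by_contra h
    rw [not_nonempty_iff] at h
    have hss := subsingleton_of_isEmpty (G := G₂)
    obtain ⟨J, hJ, u, hu, v, hv, huv, huJ, hvJ⟩ :=
      exists_ne_mem_of_infinite (Set.Icc_infinite hst) hQ (hsub.trans hQD)
    obtain ⟨-, k, c, hk, hkc⟩ := hQa J hJ
    have h1 := hkc u ⟨huJ, hsub hu⟩
    have h2 := hkc v ⟨hvJ, hsub hv⟩
    rw [hinj (Subsingleton.elim (φ (G₁.edge e (ENNReal.ofReal u)))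
      (φ (G₁.edge e (ENNReal.ofReal v)))), h2] at h1
    rcases hk with rfl | rfl <;> push_cast at h1 <;> exact huv (by linarith)
  have h₂ne : ψ (Rat.negDist x hx) ≠ 0 :=
    (map_ne_zero_iff ψ ψ.injective).2 (Rat.negDist_ne_zero x hx)
  choose P hP hPD hPa using fun e' => exists_dist_slopes hφx e'
  choose K hK hKD hKa using fun e' => Rat.exists_pieces h₂ne e'
  -- Parameters are grouped by the piece `J` of the distance to `x`, the edge `e'` that contains the
  -- image, and the pieces `I`, `L` of the two functions on `e'`. On one group, all the functions
  -- involved are given by fixed affine formulas.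
  let S : Set (Set ℝ) := ⋃ e' : G₂.E, (fun q : Set ℝ × Set ℝ × Set ℝ => {u | u ∈ q.1 ∧
    ∃ s' ∈ params e', s' ∈ q.2.1 ∧ s' ∈ q.2.2 ∧
      G₂.edge e' (ENNReal.ofReal s') = φ (G₁.edge e (ENNReal.ofReal u))}) '' (Q ×ˢ P e' ×ˢ K e')
  have hS : S.Finite := Set.finite_iUnion fun e' => (hQ.prod ((hP e').prod (hK e'))).image _
  have hcover : Set.Icc s t ⊆ ⋃₀ S := by
    intro u hu
    obtain ⟨e', s', hs', he'⟩ := exists_edge_ofReal_eq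
      (map_mem_finitePoints (fun f => hφ f _) (edge_ofReal_mem_finitePoints (hsub hu)))
    obtain ⟨J, hJ, huJ⟩ := hQD (hsub hu)
    obtain ⟨I, hI, hsI⟩ := hPD e' hs'
    obtain ⟨L, hL, hsL⟩ := hKD e' hs'
    exact ⟨_, Set.mem_iUnion.2 ⟨e', (J, I, L), ⟨hJ, hI, hL⟩, rfl⟩, huJ, s', hs', hsI, hsL, he'⟩
  obtain ⟨_, hT, u, hu, v, hv, huv, huT, hvT⟩ :=
    exists_ne_mem_of_infinite (Set.Icc_infinite hst) hS hcover
  obtain ⟨e', ⟨J, I, L⟩, ⟨hJ, hI, hL⟩, rfl⟩ := Set.mem_iUnion.1 hT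
  obtain ⟨huJ, s₁, hs₁, hs₁I, hs₁L, hes₁⟩ := huT
  obtain ⟨hvJ, s₂, hs₂, hs₂I, hs₂L, hes₂⟩ := hvT
  obtain ⟨-, ε, c₁, hε, hJ'⟩ := hQa J hJ
  obtain ⟨-, δ, c₂, hδ, hI'⟩ := hPa e' I hI
  obtain ⟨-, k, c₃, hL'⟩ := hKa e' L hL
  have key : ∀ w ∈ Set.Icc s t, w ∈ J → ∀ s' ∈ params e', s' ∈ I → s' ∈ L →
      G₂.edge e' (ENNReal.ofReal s') = φ (G₁.edge e (ENNReal.ofReal w)) →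
      k * s' + c₃ = -r * (ε * w + c₁) ∧ -(δ * s' + c₂) = r * (a * w + b) := by
    intro w hw hwJ s' hs' hsI hsL hes
    constructor
    · rw [← hJ' w ⟨hwJ, hsub hw⟩, ← hL' s' ⟨hsL, hs'⟩, hes, hφ, EReal.toReal_mul,
        Rat.toReal_negDist_apply, EReal.toReal_coe]
      ring
    · rw [← hI' s' ⟨hsI, hs'⟩, ← hab w hw, hes, ← Rat.toReal_negDist_apply (φ x) hφx,
        ← ψ.apply_symm_apply (Rat.negDist (φ x) hφx), hφ, EReal.toReal_mul, EReal.toReal_coe,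
        ψ.apply_symm_apply]
  obtain ⟨h1, h2⟩ := key u hu huJ s₁ hs₁ hs₁I hs₁L hes₁
  obtain ⟨h3, h4⟩ := key v hv hvJ s₂ hs₂ hs₂I hs₂L hes₂
  -- Taking differences at `u` and `v` removes the constant terms, and combining the two equations
  -- eliminates `s₁ - s₂`.
  have h5 : r * ((a : ℝ) * k - ε * δ) * (u - v) = 0 := by
    linear_combination (-δ : ℝ) * (h1 - h3) - k * (h2 - h4)
  have h6 := (mul_eq_zero.1 ((mul_eq_zero.1 h5).resolve_right (sub_ne_zero.2 huv))).resolve_left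
    hr.ne'
  have h7 : a * k = ε * δ := by exact_mod_cast sub_eq_zero.1 h6
  have h8 : IsUnit a := by
    refine isUnit_of_mul_isUnit_left (y := k) ?_
    rw [h7]
    exact (Int.isUnit_iff.2 hε).mul (Int.isUnit_iff.2 hδ)
  rcases Int.isUnit_iff.1 h8 with rfl | rfl <;> simp

/-- The pullback of minus the distance to `φ x` has slopes bounded by one, so `le_add_dist` applies
to its negative. -/
theorem dist_map_le (hr : 0 < r) {φ : G₁.Point → G₂.Point}
    (hφ : ∀ f x, ψ f (φ x) = (r : EReal) * f x) (hinj : Function.Injective φ) {x y : G₁.Point}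
    (hx : x ∈ G₁.finitePoints) (hy : y ∈ G₁.finitePoints) :
    G₂.dist (φ x) (φ y) ≤ ENNReal.ofReal r * G₁.dist x y := by
  have hφx : φ x ∈ G₂.finitePoints := map_mem_finitePoints (fun f => hφ f x) hx
  set f := ψ.symm (Rat.negDist (φ x) hφx) with hf
  have hf0 : f ≠ 0 := (map_ne_zero_iff _ ψ.symm.injective).2 (Rat.negDist_ne_zero _ _)
  have hdist : ∀ p, (G₂.dist (φ x) (φ p)).toReal = r * -(f p).toReal := by
    intro p
    have := Rat.toReal_negDist_apply (φ x) hφx (φ p)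
    rw [← ψ.apply_symm_apply (Rat.negDist (φ x) hφx), hφ, EReal.toReal_mul, EReal.toReal_coe] at this
    linarith
  -- At a point at infinity `toReal` gives a junk value. This is harmless, since there the Lipschitz
  -- bound is trivial.
  let F : G₁.Point → ℝ≥0∞ := fun p => ENNReal.ofReal (-(f p).toReal)
  have hlip : ∀ e s t, s ≤ G₁.len e → t ≤ G₁.len e →
      F (G₁.edge e t) ≤ F (G₁.edge e s) + ((s - t) + (t - s)) := by
    intro e s t hs ht
    rcases eq_or_ne s t with rfl | hst
    · exact le_self_add
    rcases eq_or_ne s ⊤ with rfl | hs'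
    · rw [ENNReal.top_sub hst.symm]
      simp
    rcases eq_or_ne t ⊤ with rfl | ht'
    · rw [ENNReal.top_sub hst]
      simp
    have h1 := Rat.abs_sub_le (K := 1) hf0 e
      (fun s t a b hst hsub hab => abs_slope_le_one hr hφ hinj hx e hst hsub hab)
      _ (toReal_mem_params hs hs') _ (toReal_mem_params ht ht')
    rw [ENNReal.ofReal_toReal hs', ENNReal.ofReal_toReal ht', one_mul, abs_le] at h1
    rw [← ENNReal.ofReal_toReal hs', ← ENNReal.ofReal_toReal ht',
      ← ENNReal.ofReal_sub _ ENNReal.toReal_nonneg, ← ENNReal.ofReal_sub _ ENNReal.toReal_nonneg,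
      ENNReal.ofReal_toReal hs', ENNReal.ofReal_toReal ht']
    rcases le_total s.toReal t.toReal with h | h
    · rw [abs_of_nonneg (sub_nonneg.2 h)] at h1
      refine (ENNReal.ofReal_le_ofReal (q := -(f (G₁.edge e s)).toReal + (t.toReal - s.toReal))
        (by linarith [h1.1])).trans (ENNReal.ofReal_add_le.trans ?_)
      exact add_le_add_right le_add_self _
    · rw [abs_of_nonpos (sub_nonpos.2 h)] at h1
      refine (ENNReal.ofReal_le_ofReal (q := -(f (G₁.edge e s)).toReal + (s.toReal - t.toReal))
        (by linarith [h1.1])).trans (ENNReal.ofReal_add_le.trans ?_)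
      exact add_le_add_right le_self_add _
  have h := le_add_dist hlip x y
  have hFx : F x = 0 := by
    have := hdist x
    rw [dist_self, ENNReal.toReal_zero] at this
    have h0 := (mul_eq_zero.1 this.symm).resolve_left hr.ne'
    simp only [F, h0, ENNReal.ofReal_zero]
  rw [hFx, zero_add] at h
  have hφy : φ y ∈ G₂.finitePoints := map_mem_finitePoints (fun f => hφ f y) hy
  calc G₂.dist (φ x) (φ y) = ENNReal.ofReal r * F y := by
        rw [← ENNReal.ofReal_mul hr.le, ← hdist, ENNReal.ofReal_toReal (dist_ne_top hφx hφy)]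
    _ ≤ _ := by gcongr

theorem dist_map_eq (hr : 0 < r) {φ : G₁.Point ≃ G₂.Point}
    (hφ : ∀ f x, ψ f (φ x) = (r : EReal) * f x) {x y : G₁.Point}
    (hx : x ∈ G₁.finitePoints) (hy : y ∈ G₁.finitePoints) :
    G₂.dist (φ x) (φ y) = ENNReal.ofReal r * G₁.dist x y := by
  refine le_antisymm (dist_map_le hr hφ φ.injective hx hy) ?_
  have hφ' : ∀ g z, ψ.symm g (φ.symm z) = ((r⁻¹ : ℝ) : EReal) * g z := fun g z =>
    symm_apply_eq hr (fun f => by rw [← hφ, φ.apply_symm_apply]) g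
  have h := dist_map_le (inv_pos.2 hr) hφ' φ.symm.injective
    (map_mem_finitePoints (fun f => hφ f x) hx) (map_mem_finitePoints (fun f => hφ f y) hy)
  rw [φ.symm_apply_apply, φ.symm_apply_apply] at h
  calc _ ≤ ENNReal.ofReal r * (ENNReal.ofReal r⁻¹ * G₂.dist (φ x) (φ y)) := by gcongr
    _ = _ := by
      rw [← mul_assoc, ← ENNReal.ofReal_mul hr.le, mul_inv_cancel₀ hr.ne', ENNReal.ofReal_one,
        one_mul]

end EdgeWeightedGraph

/-! ### The induced map: rays, existence and uniqueness -/

namespace EdgeWeightedGraph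

variable {G : EdgeWeightedGraph}

theorem rayDist_eq_sub (e : G.E) (t : ℝ≥0∞) (x : G.Point) :
    rayDist e t x = rayDist e 0 x - t := by
  cases x <;> simp only [rayDist] <;> split_ifs <;> simp

theorem mem_ray_iff {e : G.E} (he : G.len e = ⊤) {t : ℝ≥0∞} {x : G.Point} :
    x ∈ ray e t ↔ t < rayDist e 0 x := by
  classical
  constructor
  · rintro ⟨s, ⟨hs, -⟩, rfl⟩
    rwa [rayDist_edge he 0 (he ▸ le_top), if_pos rfl, tsub_zero]
  · intro h
    have : Nonempty G.E := ⟨e⟩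
    obtain ⟨e', s, hs, rfl⟩ := exists_edge_eq x
    rw [rayDist_edge he 0 hs] at h
    split_ifs at h with h'
    · subst h'
      rw [tsub_zero] at h
      exact ⟨s, ⟨h, le_top⟩, rfl⟩
    · exact (not_lt_zero h).elim

theorem rayDist_edge_self {e : G.E} (he : G.len e = ⊤) (s : ℝ≥0∞) :
    rayDist e 0 (G.edge e s) = s := by
  classical
  rw [rayDist_edge he 0 (he ▸ le_top), if_pos rfl, tsub_zero]

theorem eq_edge_of_rayDist_ne_zero {e : G.E} (he : G.len e = ⊤) {x : G.Point}
    (hx : rayDist e 0 x ≠ 0) : x = G.edge e (rayDist e 0 x) := by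
  obtain ⟨s, -, rfl⟩ := (mem_ray_iff he).2 (pos_iff_ne_zero.2 hx)
  rw [rayDist_edge_self he]

theorem rayDist_of_notMem {e : G.E} (he : G.len e = ⊤) {t : ℝ≥0∞} {x : G.Point}
    (hx : x ∉ ray e t) : rayDist e t x = 0 := by
  rw [mem_ray_iff he, not_lt] at hx
  rw [rayDist_eq_sub, tsub_eq_zero_of_le hx]

/-- Expresses the function through distances between points, which `φ` is known to scale. -/
theorem rayDist_of_mem {e : G.E} (he : G.len e = ⊤) {t : ℝ≥0∞} {x : G.Point}
    (hx : x ∈ ray e t) : rayDist e t x = G.dist (G.edge e t) x := by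
  apply le_antisymm
  · have := le_add_dist (rayDist_lipschitz he t) (G.edge e t) x
    rwa [rayDist_eq_sub e t (G.edge e t), rayDist_edge_self he, tsub_self, zero_add] at this
  · obtain ⟨s, ⟨h1, h2⟩, rfl⟩ := hx
    have := dist_edge_le (G.edge e t) e t s (he ▸ le_top) (he ▸ le_top)
    rwa [dist_self, zero_add, tsub_eq_zero_of_le h1.le, zero_add, ← rayDist_edge_self he s,
      ← rayDist_eq_sub, rayDist_edge_self he] at this

theorem isOpen_ray {e : G.E} (he : G.len e = ⊤) (t : ℝ≥0∞) : IsOpen (ray e t) := by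
  have h : ray e t = {x | Rat.negRayDist e he 0 ENNReal.zero_ne_top x < -(t : EReal)} := by
    ext x
    rw [mem_ray_iff he, Set.mem_ofPred_eq, Rat.negRayDist_apply, EReal.neg_lt_neg_iff,
      EReal.coe_ennreal_lt_coe_ennreal_iff]
  rw [h]
  exact isOpen_lt (Rat.negRayDist e he 0 ENNReal.zero_ne_top).2.1 continuous_const

theorem tendsto_edge_top {e : G.E} (he : G.len e = ⊤) :
    Filter.Tendsto (fun t : ℝ => G.edge e (ENNReal.ofReal t)) Filter.atTop (𝓝 (G.edge e ⊤)) := by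
  have hc : Continuous (G.edge e) := by
    have := continuousOn_edge e
    rwa [he, show Set.Icc (0 : ℝ≥0∞) ⊤ = Set.univ by ext; simp, continuousOn_univ] at this
  exact (hc.tendsto ⊤).comp ENNReal.tendsto_ofReal_atTop

/-- A rational function taking the value `-∞` only at the end of an infinite edge `e` is strictly
below some negative constant exactly on a ray in `e`. -/
theorem Rat.exists_ray_eq {e : G.E} (he : G.len e = ⊤) {f : G.Rat} (hf : f ≠ 0)
    (hbot : ∀ x, f x = ⊥ ↔ x = G.edge e ⊤) :
    ∃ (c t : ℝ), c < 0 ∧ 0 ≤ t ∧ f (G.edge e (ENNReal.ofReal t)) = c ∧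
      ∀ x, x ∈ ray e (ENNReal.ofReal t) ↔ f x < c := by
  obtain ⟨a, b, hab⟩ := (isPiecewiseAffineOn hf e).eventually_affine
    (fun t ht => ⟨ht, he ▸ le_top⟩)
  -- Were the eventual slope nonnegative, `f` would stay above `b` along `e` and could not tend to
  -- `-∞`.
  have ha : a < 0 := by
    by_contra! ha
    have hlim : Filter.Tendsto (fun t : ℝ => f (G.edge e (ENNReal.ofReal t))) Filter.atTop
        (𝓝 (f (G.edge e ⊤))) := (f.2.1.tendsto _).comp (tendsto_edge_top he)
    rw [(hbot _).2 rfl] at hlim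
    have : (b : EReal) ≤ ⊥ := by
      refine ge_of_tendsto hlim ?_
      filter_upwards [hab, Filter.eventually_ge_atTop 0] with t ht ht0
      rw [ht]
      have : (0 : ℝ) ≤ a := by exact_mod_cast ha
      exact_mod_cast le_add_of_nonneg_left (mul_nonneg this ht0)
    exact EReal.coe_ne_bot b (le_bot_iff.1 this)
  have haR : (a : ℝ) < 0 := by exact_mod_cast ha
  obtain ⟨T, hT⟩ := Filter.eventually_atTop.1 (hab.and (Filter.eventually_ge_atTop 0))
  have hT0 : 0 ≤ T := (hT T le_rfl).2
  have hTK : G.edge e (ENNReal.ofReal T) ∈ (ray e (ENNReal.ofReal T))ᶜ := by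
    rw [Set.mem_compl_iff, mem_ray_iff he, rayDist_edge_self he]
    exact lt_irrefl _
  obtain ⟨p₀, hp₀, hmin⟩ := (isOpen_ray he (ENNReal.ofReal T)).isClosed_compl.isCompact
    |>.exists_isMinOn ⟨_, hTK⟩ f.2.1.continuousOn
  -- Outside the ray beyond `T` the function has a minimum above `-∞`, so `c` can be taken below it
  -- and below `0`. The level `c` is then crossed only in the affine part, at the solution `(c - b)
  -- / a` of `a * t + b = c`.
  have hp₀b : ⊥ < min (f p₀) 0 := by
    refine lt_min (bot_lt_iff_ne_bot.2 fun h => hp₀ ?_) (by simp)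
    rw [(hbot p₀).1 h, mem_ray_iff he, rayDist_edge_self he]
    exact ENNReal.ofReal_lt_top
  obtain ⟨c, -, hc⟩ := EReal.lt_iff_exists_real_btwn.1 hp₀b
  have hcK : ∀ x ∉ ray e (ENNReal.ofReal T), (c : EReal) < f x := fun x hx =>
    (hc.trans_le (min_le_left _ _)).trans_le (hmin hx)
  have hTt : T < (c - b) / a := by
    have := hcK _ hTK
    rw [(hT T le_rfl).1] at this
    have : c < a * T + b := by exact_mod_cast this
    rw [lt_div_iff_of_neg haR]
    linarith
  refine ⟨c, (c - b) / a, ?_, hT0.trans hTt.le, ?_, fun x => ?_⟩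
  · exact_mod_cast hc.trans_le (min_le_right _ _)
  · rw [(hT _ hTt.le).1, mul_div_cancel₀ _ haR.ne, sub_add_cancel]
  · have key : ∀ t, t ≥ T → (f (G.edge e (ENNReal.ofReal t)) < c ↔ (c - b) / a < t) := by
      intro t ht
      rw [(hT t ht).1, EReal.coe_lt_coe_iff, div_lt_iff_of_neg haR]
      constructor <;> intro <;> linarith
    constructor
    · rintro ⟨s, ⟨hs, -⟩, rfl⟩
      rcases eq_or_ne s ⊤ with rfl | hs'
      · rw [(hbot _).2 rfl]
        exact EReal.bot_lt_coe c
      · rw [ENNReal.ofReal_lt_iff_lt_toReal (hT0.trans hTt.le) hs'] at hs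
        rw [← ENNReal.ofReal_toReal hs']
        exact (key _ (hTt.trans hs).le).2 hs
    · intro hx
      obtain ⟨s, ⟨hs, -⟩, rfl⟩ : x ∈ ray e (ENNReal.ofReal T) := by
        by_contra hx'
        exact lt_asymm hx (hcK x hx')
      refine ⟨s, ⟨?_, le_top⟩, rfl⟩
      rcases eq_or_ne s ⊤ with rfl | hs'
      · exact ENNReal.ofReal_lt_top
      · rw [ENNReal.ofReal_lt_iff_lt_toReal hT0 hs'] at hs
        rw [ENNReal.ofReal_lt_iff_lt_toReal (hT0.trans hTt.le) hs']
        rw [← ENNReal.ofReal_toReal hs'] at hx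
        exact (key _ hs.le).1 hx

theorem Rat.negDist_add_ofReal_val (x : G.Point) (hx : x ∈ G.finitePoints) {ε : ℝ} (hε : 0 ≤ ε) :
    (negDist x hx + ofReal (-ε)).1 = chipFiring {x} (ENNReal.ofReal ε) := by
  funext y
  change max (negDist x hx y) (ofReal (-ε) y) = _
  have hneg : ∀ a b : EReal, max (-a) (-b) = -min a b := fun a b => by
    rcases le_total a b with h | h
    · rw [min_eq_left h, max_eq_left (EReal.neg_le_neg_iff.2 h)]
    · rw [min_eq_right h, max_eq_right (EReal.neg_le_neg_iff.2 h)]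
  rw [chipFiring_singleton, negDist_apply, ofReal_apply, EReal.coe_neg, hneg, min_comm,
    EReal.coe_ennreal_strictMono.monotone.map_min, EReal.coe_ennreal_ofReal, max_eq_left hε]

variable {G₁ G₂ : EdgeWeightedGraph} {ψ : G₁.Rat ≃+* G₂.Rat} {r : ℝ}

theorem symm_map_apply (hr : 0 < r) {φ : G₁.Point ≃ G₂.Point}
    (hφ : ∀ f x, ψ f (φ x) = (r : EReal) * f x) (g : G₂.Rat) (z : G₂.Point) :
    ψ.symm g (φ.symm z) = ((r⁻¹ : ℝ) : EReal) * g z :=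
  symm_apply_eq hr (fun f => by rw [← hφ, φ.apply_symm_apply]) g

theorem map_mem_finitePoints_iff (hr : 0 < r) {φ : G₁.Point ≃ G₂.Point}
    (hφ : ∀ f x, ψ f (φ x) = (r : EReal) * f x) {x : G₁.Point} :
    φ x ∈ G₂.finitePoints ↔ x ∈ G₁.finitePoints := by
  refine ⟨fun h => ?_, map_mem_finitePoints fun f => hφ f x⟩
  have := map_mem_finitePoints (ψ := ψ.symm) (z := φ.symm (φ x))
    (fun g => symm_map_apply hr hφ g (φ x)) h
  rwa [φ.symm_apply_apply] at this

theorem map_negDist (hr : 0 < r) {φ : G₁.Point ≃ G₂.Point}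
    (hφ : ∀ f x, ψ f (φ x) = (r : EReal) * f x) {x : G₁.Point} (hx : x ∈ G₁.finitePoints) :
    ψ (Rat.negDist x hx) = Rat.negDist (φ x) ((map_mem_finitePoints_iff hr hφ).2 hx) := by
  refine Rat.ext_finite fun z hz => ?_
  obtain ⟨y, rfl⟩ := φ.surjective z
  rw [hφ, Rat.negDist_apply, Rat.negDist_apply,
    dist_map_eq hr hφ hx ((map_mem_finitePoints_iff hr hφ).1 hz), EReal.coe_ennreal_mul,
    EReal.coe_ennreal_ofReal, max_eq_left hr.le, mul_neg]

theorem Rat.negRayDist_val (e : G.E) (he : G.len e = ⊤) (t : ℝ≥0∞) (ht : t ≠ ⊤) :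
    (negRayDist e he t ht).1 = chipFiring (ray e t)ᶜ ⊤ := funext fun x => (chipFiring_compl_ray he t x).symm

/-- At finite points any `ε` would do, and `1` is taken. At infinity, the infinite edges at `x` and
`φ x` are not assumed to correspond. That far parts of them do is deduced by comparing sublevel sets
of a function and its preimage under `ψ`. -/
theorem isInducedBy (hr : 0 < r) (hψ : ∀ c, ψ (Rat.ofReal c) = Rat.ofReal (r * c))
    {φ : G₁.Point ≃ G₂.Point} (hφ : ∀ f x, ψ f (φ x) = (r : EReal) * f x) :
    IsInducedBy ψ r φ := by
  constructor
  · intro x hx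
    refine ⟨(map_mem_finitePoints_iff hr hφ).2 hx, 1, one_pos, _,
      Rat.negDist_add_ofReal_val x hx zero_le_one, ?_⟩
    rw [map_add, map_negDist hr hφ, hψ, mul_neg]
    exact Rat.negDist_add_ofReal_val _ _ (by rw [mul_one]; exact hr.le)
  · intro x hx
    have hφx : φ x ∈ G₂.infinitePoints := by
      by_contra h
      exact (map_mem_finitePoints_iff hr hφ).1 h hx
    refine ⟨hφx, ?_⟩
    obtain ⟨e₁, he₁, rfl⟩ := hx
    obtain ⟨e₂, he₂, hφe⟩ := hφx
    -- The preimage `f` of minus the coordinate along `e₂` takes the value `-∞` only at the end of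
    -- `e₁`. Its sublevel set below `c` is a ray in `e₁`, which `φ` carries onto the sublevel set of
    -- `F` below `r * c`, a ray in `e₂`.
    set F := Rat.negRayDist e₂ he₂ 0 ENNReal.zero_ne_top with hF
    set f := ψ.symm F with hf
    have hFf : ∀ x, F (φ x) = (r : EReal) * f x := fun x => by rw [← hφ, hf, ψ.apply_symm_apply]
    have hff : ∀ x, f x = ((r⁻¹ : ℝ) : EReal) * F (φ x) := fun x => by
      rw [← symm_map_apply hr hφ, φ.symm_apply_apply]
    have hbot : ∀ x, f x = ⊥ ↔ x = G₁.edge e₁ ⊤ := by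
      intro x
      have h1 : F (φ x) = ⊥ ↔ φ x = φ (G₁.edge e₁ ⊤) := by
        rw [hφe, ← rayDist_eq_top_iff he₂ ENNReal.zero_ne_top, hF, Rat.negRayDist_apply]
        simp
      rw [← φ.apply_eq_iff_eq, ← h1]
      constructor
      · intro h
        rw [hFf, h, EReal.coe_mul_bot_of_pos hr]
      · intro h
        rw [hff, h, EReal.coe_mul_bot_of_pos (inv_pos.2 hr)]
    have hf0 : f ≠ 0 := by
      obtain ⟨x, hx⟩ := exists_finitePoint (G := G₁)
      intro h
      refine hx ⟨e₁, he₁, (hbot x).1 ?_⟩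
      rw [h, Rat.zero_apply]
    obtain ⟨c, t, hc, ht, hct, hray⟩ := Rat.exists_ray_eq he₁ hf0 hbot
    have hrc : 0 < -(r * c) := by nlinarith
    have hlt : ∀ x, f x < c ↔ F (φ x) < ((r * c : ℝ) : EReal) := by
      intro x
      rw [hFf]
      generalize f x = w
      induction w with
      | bot =>
        rw [EReal.coe_mul_bot_of_pos hr]
        exact iff_of_true (EReal.bot_lt_coe _) (EReal.bot_lt_coe _)
      | top =>
        rw [EReal.coe_mul_top_of_pos hr]
        exact iff_of_false not_top_lt not_top_lt
      | coe w =>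
        rw [← EReal.coe_mul, EReal.coe_lt_coe_iff, EReal.coe_lt_coe_iff, mul_lt_mul_iff_right₀ hr]
    have hcoe : ((ENNReal.ofReal (-(r * c)) : ℝ≥0∞) : EReal) = -((r * c : ℝ) : EReal) := by
      rw [EReal.coe_ennreal_ofReal, max_eq_left hrc.le, EReal.coe_neg]
    have hmem : ∀ x, φ x ∈ ray e₂ (ENNReal.ofReal (-(r * c))) ↔
        x ∈ ray e₁ (ENNReal.ofReal t) := by
      intro x
      rw [hray, hlt, mem_ray_iff he₂, hF, Rat.negRayDist_apply,
        ← EReal.coe_ennreal_lt_coe_ennreal_iff, hcoe, EReal.neg_lt_comm]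
    -- The coordinate of the image along `e₂` is `-(r * c)`. As it is nonzero, it determines the
    -- point.
    have hφt : φ (G₁.edge e₁ (ENNReal.ofReal t)) = G₂.edge e₂ (ENNReal.ofReal (-(r * c))) := by
      have h1 := hFf (G₁.edge e₁ (ENNReal.ofReal t))
      rw [hct, ← EReal.coe_mul, hF, Rat.negRayDist_apply, neg_eq_iff_eq_neg, ← hcoe,
        EReal.coe_ennreal_eq_coe_ennreal_iff] at h1
      rw [eq_edge_of_rayDist_ne_zero he₂ (x := φ _) (by
        rw [h1]
        exact (ENNReal.ofReal_pos.2 hrc).ne'), h1]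
    refine ⟨e₁, e₂, ENNReal.ofReal t, ENNReal.ofReal (-(r * c)), he₁, rfl, ENNReal.ofReal_ne_top,
      he₂, hφe.symm, ENNReal.ofReal_ne_top, hφt, _,
      Rat.negRayDist_val e₁ he₁ _ ENNReal.ofReal_ne_top, ?_⟩
    rw [← Rat.negRayDist_val e₂ he₂ _ ENNReal.ofReal_ne_top]
    refine congrArg Subtype.val (Rat.ext_finite fun z hz => ?_)
    obtain ⟨x, rfl⟩ := φ.surjective z
    have hx := (map_mem_finitePoints_iff hr hφ).1 hz
    rw [hφ, Rat.negRayDist_apply, Rat.negRayDist_apply]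
    by_cases h : x ∈ ray e₁ (ENNReal.ofReal t)
    · rw [rayDist_of_mem he₁ h, rayDist_of_mem he₂ ((hmem x).2 h), ← hφt,
        dist_map_eq hr hφ (edge_mem_finitePoints (he₁ ▸ le_top) ENNReal.ofReal_ne_top) hx,
        EReal.coe_ennreal_mul, EReal.coe_ennreal_ofReal, max_eq_left hr.le, mul_neg]
    · rw [rayDist_of_notMem he₁ h, rayDist_of_notMem he₂ (fun h' => h ((hmem x).1 h'))]
      simp

/-- The move at `x` vanishes at `x`, so its image vanishes at `φ x`; but the latter vanishes only at
its centre `φ' x`. At infinity the value `-∞` plays this role. -/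
theorem IsInducedBy.eq (hr : 0 < r) {φ φ' : G₁.Point → G₂.Point}
    (hφ : ∀ f x, ψ f (φ x) = (r : EReal) * f x) (h : IsInducedBy ψ r φ') : φ' = φ := by
  funext x
  by_cases hx : x ∈ G₁.finitePoints
  · obtain ⟨-, ε, hε, f, hf, hψf⟩ := h.1 x hx
    have h1 := hφ f x
    have hf0 : f x = 0 := by
      rw [hf, chipFiring_singleton, dist_self]
      simp
    rw [hf0, hψf, chipFiring_singleton, mul_zero] at h1
    have h2 : min (ENNReal.ofReal (r * ε)) (G₂.dist (φ' x) (φ x)) = 0 := by simpa using h1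
    rcases min_choice (ENNReal.ofReal (r * ε)) (G₂.dist (φ' x) (φ x)) with h3 | h3
    · rw [h3] at h2
      exact ((ENNReal.ofReal_pos.2 (mul_pos hr hε)).ne' h2).elim
    · exact eq_of_dist_eq_zero (h3 ▸ h2)
  · obtain ⟨-, e₁, e₂, t₁, t₂, he₁, rfl, ht₁, he₂, hex, ht₂, -, f, hf, hψf⟩ :=
      h.2 x (not_not.1 hx)
    have h1 := hφ f (G₁.edge e₁ ⊤)
    rw [hf, hψf, chipFiring_compl_ray he₁, chipFiring_compl_ray he₂,
      rayDist_edge_top he₁ ht₁, EReal.coe_ennreal_top, EReal.neg_top,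
      EReal.coe_mul_bot_of_pos hr] at h1
    have h2 : rayDist e₂ t₂ (φ (G₁.edge e₁ ⊤)) = ⊤ := by simpa using h1
    rw [← hex, (rayDist_eq_top_iff he₂ ht₂).1 h2]

theorem isExpansive (hr : 0 < r) {φ : G₁.Point ≃ₜ G₂.Point}
    (hφ : ∀ f x, ψ f (φ x) = (r : EReal) * f x) : IsExpansive r φ := by
  have hφ' : ∀ f x, ψ f (φ.toEquiv x) = (r : EReal) * f x := hφ
  refine ⟨φ.continuous, φ.bijective, ⟨fun x hx => (map_mem_finitePoints_iff hr hφ').2 hx,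
    φ.injective.injOn, fun z hz => ?_⟩, fun x hx y hy => dist_map_eq hr hφ' hx hy⟩
  obtain ⟨x, rfl⟩ := φ.surjective z
  exact ⟨x, (map_mem_finitePoints_iff hr hφ').1 hz, rfl⟩

end EdgeWeightedGraph

/-! ### Loopless models and harmonic morphisms -/

namespace EdgeWeightedGraph

variable {G : EdgeWeightedGraph}

open Classical in
/-- The parameter at which the edge `e` is subdivided. -/
noncomputable def cut (e : G.E) : ℝ≥0∞ := if G.len e = ⊤ then 1 else G.len e / 2

theorem cut_pos (e : G.E) : 0 < cut e := by
  unfold cut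
  split_ifs
  · exact one_pos
  · exact ENNReal.half_pos (G.len_pos e).ne'

theorem cut_lt_len (e : G.E) : cut e < G.len e := by
  unfold cut
  split_ifs with h
  · rw [h]
    exact ENNReal.one_lt_top
  · exact ENNReal.half_lt_self (G.len_pos e).ne' h

variable (G) in
/-- The subdivision of every edge into two edges, which is a loopless graph. -/
noncomputable abbrev subdivision : EdgeWeightedGraph where
  V := G.V ⊕ G.E
  E := G.E ⊕ G.E
  src := Sum.elim (fun e => .inl (G.src e)) (fun e => .inr e)
  tgt := Sum.elim (fun e => .inr e) (fun e => .inl (G.tgt e))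
  len := Sum.elim cut (fun e => G.len e - cut e)
  len_pos := by
    rintro (e | e)
    · exact cut_pos e
    · exact tsub_pos_of_lt (cut_lt_len e)
  connected := by
    set R : G.V ⊕ G.E → G.V ⊕ G.E → Prop := fun a b => ∃ e,
      Sum.elim (fun e => Sum.inl (G.src e)) (fun e => Sum.inr e) e = a ∧
      Sum.elim (fun e => Sum.inr e) (fun e => Sum.inl (G.tgt e)) e = b with hR
    have h1 : ∀ e, Relation.EqvGen R (.inl (G.src e)) (.inr e) := fun e =>
      .rel _ _ ⟨.inl e, rfl, rfl⟩
    have h2 : ∀ e, Relation.EqvGen R (.inr e) (.inl (G.tgt e)) := fun e =>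
      .rel _ _ ⟨.inr e, rfl, rfl⟩
    have h3 : ∀ v w : G.V, Relation.EqvGen (fun a b => ∃ e, G.src e = a ∧ G.tgt e = b) v w →
        Relation.EqvGen R (.inl v) (.inl w) := by
      intro v w h
      induction h with
      | rel a b h =>
        obtain ⟨e, rfl, rfl⟩ := h
        exact (h1 e).trans _ _ _ (h2 e)
      | refl a => exact .refl _
      | symm a b _ ih => exact ih.symm
      | trans a b c _ _ ih ih' => exact ih.trans _ _ _ ih'
    have h4 : ∀ a, ∃ v, Relation.EqvGen R a (.inl v) := by
      rintro (v | e)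
      · exact ⟨v, .refl _⟩
      · exact ⟨_, h2 e⟩
    intro a b
    obtain ⟨v, hv⟩ := h4 a
    obtain ⟨w, hw⟩ := h4 b
    exact (hv.trans _ _ _ (h3 v w (G.connected v w))).trans _ _ _ hw.symm
  leaf := by
    -- Cuts are at finite parameters, so only the second half of an infinite edge is infinite, and
    -- its end is the old end at infinity.
    rintro (e | e) he
    · exact absurd he ((cut_lt_len e).trans_le le_top).ne
    · have hlen : G.len e = ⊤ := by
        by_contra h
        exact ENNReal.sub_ne_top h he
      rw [Nat.card_eq_zero.2 (Or.inl ⟨?_⟩), Nat.card_eq_one_iff_unique.2 ⟨⟨?_⟩, ?_⟩]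
      · rintro ⟨e₁ | e₁, h₁⟩ ⟨e₂ | e₂, h₂⟩
        · cases h₁
        · cases h₁
        · cases h₂
        · rw [Subtype.mk.injEq, eq_of_tgt_eq hlen (Sum.inl.inj h₁),
            eq_of_tgt_eq hlen (Sum.inl.inj h₂)]
      · exact ⟨⟨.inr e, rfl⟩⟩
      · rintro ⟨e' | e', h⟩
        · exact src_ne_of_len_eq_top hlen e' (Sum.inl.inj h)
        · cases h

theorem subdivision_len_inl (e : G.E) : G.subdivision.len (.inl e) = cut e := rfl

theorem subdivision_len_inr (e : G.E) : G.subdivision.len (.inr e) = G.len e - cut e := rfl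

theorem subdivision_edge_cut (e : G.E) :
    G.subdivision.edge (.inl e) (cut e) = G.subdivision.edge (.inr e) 0 := by
  rw [edge_zero, ← subdivision_len_inl, edge_len]
  rfl

/-- The identification of the curve of the subdivision with the curve of the graph. -/
noncomputable def ofSubdivision : G.subdivision.Point → G.Point
  | .vertex (.inl v) => .vertex v
  | .vertex (.inr e) => G.edge e (cut e)
  | .inner (.inl e) t _ _ => G.edge e t
  | .inner (.inr e) t _ _ => G.edge e (cut e + t)

theorem ofSubdivision_edge_inl (e : G.E) {t : ℝ≥0∞} (ht : t ≤ cut e) :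
    ofSubdivision (G.subdivision.edge (.inl e) t) = G.edge e t := by
  rcases eq_or_ne t 0 with rfl | h0
  · rw [edge_zero, edge_zero]
    rfl
  rcases ht.lt_or_eq with h1 | rfl
  · rw [edge_inner (G := G.subdivision) (.inl e) t (pos_iff_ne_zero.2 h0) h1]
    rfl
  · rw [← subdivision_len_inl, edge_len]
    rfl

theorem ofSubdivision_edge_inr (e : G.E) {t : ℝ≥0∞} (ht : t ≤ G.len e - cut e) :
    ofSubdivision (G.subdivision.edge (.inr e) t) = G.edge e (cut e + t) := by
  rcases eq_or_ne t 0 with rfl | h0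
  · rw [edge_zero, add_zero]
    rfl
  rcases ht.lt_or_eq with h1 | rfl
  · rw [edge_inner (G := G.subdivision) (.inr e) t (pos_iff_ne_zero.2 h0) h1]
    rfl
  · rw [← subdivision_len_inr, edge_len, subdivision_len_inr,
      add_tsub_cancel_of_le (cut_lt_len e).le, edge_len]
    rfl

open Classical in
/-- The inverse of `ofSubdivision`. -/
noncomputable def toSubdivision : G.Point → G.subdivision.Point
  | .vertex v => .vertex (.inl v)
  | .inner e t _ _ => if t ≤ cut e then G.subdivision.edge (.inl e) t
      else G.subdivision.edge (.inr e) (t - cut e)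

theorem toSubdivision_edge_of_le (e : G.E) {t : ℝ≥0∞} (ht : t ≤ cut e) :
    toSubdivision (G.edge e t) = G.subdivision.edge (.inl e) t := by
  rcases eq_or_ne t 0 with rfl | h0
  · rw [edge_zero, edge_zero]
    rfl
  · rw [edge_inner e t (pos_iff_ne_zero.2 h0) (ht.trans_lt (cut_lt_len e))]
    exact if_pos ht

theorem toSubdivision_edge_of_ge (e : G.E) {t : ℝ≥0∞} (ht : cut e ≤ t) (ht' : t ≤ G.len e) :
    toSubdivision (G.edge e t) = G.subdivision.edge (.inr e) (t - cut e) := by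
  rcases ht.eq_or_lt with rfl | h
  · rw [toSubdivision_edge_of_le e le_rfl, tsub_self, subdivision_edge_cut]
  rcases ht'.lt_or_eq with h1 | rfl
  · rw [edge_inner e t ((cut_pos e).trans h) h1]
    exact if_neg (not_le.2 h)
  · rw [edge_len, ← subdivision_len_inr, edge_len]
    rfl

theorem toSubdivision_ofSubdivision (x : G.subdivision.Point) :
    toSubdivision (ofSubdivision x) = x := by
  rcases x with (v | e) | ⟨e | e, t, h, h'⟩
  · rfl
  · change toSubdivision (G.edge e (cut e)) = _
    rw [toSubdivision_edge_of_le e le_rfl, ← subdivision_len_inl, edge_len]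
    rfl
  · change toSubdivision (G.edge e t) = _
    rw [toSubdivision_edge_of_le e h'.le, edge_inner]
  · change toSubdivision (G.edge e (cut e + t)) = _
    have hc : cut e ≠ ⊤ := ((cut_lt_len e).trans_le le_top).ne
    rw [toSubdivision_edge_of_ge e le_self_add, ENNReal.add_sub_cancel_left hc, edge_inner]
    rw [← add_tsub_cancel_of_le (cut_lt_len e).le]
    exact add_le_add_right h'.le _

theorem ofSubdivision_toSubdivision (x : G.Point) : ofSubdivision (toSubdivision x) = x := by
  cases x with
  | vertex v => rfl
  | inner e t h h' =>
    rw [← edge_inner e t h h']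
    rcases le_total t (cut e) with ht | ht
    · rw [toSubdivision_edge_of_le e ht, ofSubdivision_edge_inl e ht]
    · rw [toSubdivision_edge_of_ge e ht h'.le,
        ofSubdivision_edge_inr e (tsub_le_tsub_right h'.le _), add_tsub_cancel_of_le ht]

theorem continuous_ofSubdivision : Continuous (ofSubdivision (G := G)) := by
  refine continuous_iSup_dom.2 fun e => continuous_coinduced_dom.2 ?_
  have h : ContinuousOn (fun t => ofSubdivision (G.subdivision.edge e t))
    (Set.Icc 0 (G.subdivision.len e)) → _ := continuousOn_iff_continuous_domRestrict.1
  refine h ?_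
  rcases e with e | e
  · refine ContinuousOn.congr ((continuousOn_edge e).mono ?_)
      fun t ht => ofSubdivision_edge_inl e ht.2
    exact Set.Icc_subset_Icc_right (cut_lt_len e).le
  · refine ContinuousOn.congr ((continuousOn_edge e).comp (s := Set.Icc 0 (G.len e - cut e))
      (f := fun t => cut e + t) (by fun_prop) fun t ht => ⟨zero_le, ?_⟩)
      fun t ht => ofSubdivision_edge_inr e ht.2
    exact (add_le_add_right ht.2 _).trans (add_tsub_cancel_of_le (cut_lt_len e).le).le

/-- Each inequality is an instance of `le_add_dist`, applied to a distance function transported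
along the identification in one direction or the other. -/
theorem dist_ofSubdivision (x y : G.subdivision.Point) :
    G.dist (ofSubdivision x) (ofSubdivision y) = G.subdivision.dist x y := by
  apply le_antisymm
  · have := le_add_dist (F := fun p => G.dist (ofSubdivision x) (ofSubdivision p)) ?_ x y
    · simpa [dist_self] using this
    rintro (e | e) s t hs ht
    · rw [ofSubdivision_edge_inl e hs, ofSubdivision_edge_inl e ht]
      exact dist_edge_le _ e s t (le_trans hs (cut_lt_len e).le) (le_trans ht (cut_lt_len e).le)
    · have hle : ∀ u ≤ G.len e - cut e, cut e + u ≤ G.len e := fun u hu =>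
        (add_le_add_right hu _).trans (add_tsub_cancel_of_le (cut_lt_len e).le).le
      have hc : cut e ≠ ⊤ := ((cut_lt_len e).trans_le le_top).ne
      have := dist_edge_le (ofSubdivision x) e _ _ (hle s hs) (hle t ht)
      rwa [ENNReal.add_sub_add_eq_sub_left hc, ENNReal.add_sub_add_eq_sub_left hc,
        ← ofSubdivision_edge_inr e hs, ← ofSubdivision_edge_inr e ht] at this
  · have := le_add_dist (F := fun q => G.subdivision.dist x (toSubdivision q)) ?_
      (ofSubdivision x) (ofSubdivision y)
    · simpa [dist_self, toSubdivision_ofSubdivision] using this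
    intro e
    have low : ∀ s t, s ≤ cut e → t ≤ cut e →
        G.subdivision.dist x (toSubdivision (G.edge e t)) ≤
          G.subdivision.dist x (toSubdivision (G.edge e s)) + ((s - t) + (t - s)) := by
      intro s t hs ht
      rw [toSubdivision_edge_of_le e hs, toSubdivision_edge_of_le e ht]
      exact dist_edge_le x _ s t hs ht
    have high : ∀ s t, cut e ≤ s → cut e ≤ t → s ≤ G.len e → t ≤ G.len e →
        G.subdivision.dist x (toSubdivision (G.edge e t)) ≤
          G.subdivision.dist x (toSubdivision (G.edge e s)) + ((s - t) + (t - s)) := by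
      intro s t hs ht hs' ht'
      rw [toSubdivision_edge_of_ge e hs hs', toSubdivision_edge_of_ge e ht ht']
      have := dist_edge_le x (.inr e) (s - cut e) (t - cut e) (tsub_le_tsub_right hs' _)
        (tsub_le_tsub_right ht' _)
      rwa [tsub_tsub_tsub_cancel_right ht, tsub_tsub_tsub_cancel_right hs] at this
    intro s t hs ht
    have hcl := (cut_lt_len e).le
    -- For parameters on opposite sides, the two bounds are chained through the cut point.
    rcases le_total s (cut e) with hsc | hsc <;> rcases le_total t (cut e) with htc | htc
    · exact low s t hsc htc
    · refine (high (cut e) t le_rfl htc hcl ht).trans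
        ((add_le_add_left (low s (cut e) hsc le_rfl) _).trans ?_)
      rw [tsub_eq_zero_of_le hsc, tsub_eq_zero_of_le htc, tsub_eq_zero_of_le (hsc.trans htc),
        zero_add, zero_add, zero_add, add_assoc, add_comm (cut e - s),
        tsub_add_tsub_cancel htc hsc]
    · refine (low (cut e) t le_rfl htc).trans
        ((add_le_add_left (high s (cut e) hsc le_rfl hs hcl) _).trans ?_)
      rw [tsub_eq_zero_of_le hsc, tsub_eq_zero_of_le htc, tsub_eq_zero_of_le (htc.trans hsc),
        add_zero, add_zero, add_zero, add_assoc, tsub_add_tsub_cancel hsc htc]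
    · exact high s t hsc htc hs ht

/-- Every tropical curve has a loopless model. -/
theorem exists_isLooplessModel (G : EdgeWeightedGraph) :
    ∃ (H : EdgeWeightedGraph) (h : H.Point ≃ₜ G.Point), IsLooplessModel H G h := by
  refine ⟨G.subdivision, Continuous.homeoOfEquivCompactToT2
    (f := ⟨ofSubdivision, toSubdivision, toSubdivision_ofSubdivision,
      ofSubdivision_toSubdivision⟩) continuous_ofSubdivision, dist_ofSubdivision, ?_⟩
  rintro (e | e) h <;> cases h

/-- An isometric homeomorphism is a finite harmonic morphism of degree one. -/
theorem isFiniteHarmonicOfDegree_one {G₁ G₂ : EdgeWeightedGraph} (φ : G₁.Point ≃ₜ G₂.Point)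
    (hφ : ∀ x y, G₂.dist (φ x) (φ y) = G₁.dist x y) : IsFiniteHarmonicOfDegree φ 1 := by
  classical
  refine ⟨φ.continuous, ?_⟩
  split_ifs
  · exact one_pos
  obtain ⟨H, h, hH⟩ := exists_isLooplessModel G₁
  -- One graph models both curves, through `h` and through `h` followed by `φ`. In these terms `φ`
  -- is the identity on vertices and edges.
  refine ⟨H, H, h, h.trans φ, id, id, fun _ => 1, fun _ => 1, hH,
    ⟨fun x y => (hφ _ _).trans (hH.1 x y), hH.2⟩, fun v => rfl, fun e => ?_,
    fun e => ⟨one_pos, fun x _ y _ => ?_⟩, fun v e' hv => ?_, fun v' => ?_⟩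
  · rw [Set.image_image]
    rfl
  · rw [hφ, Nat.cast_one, one_mul]
  · rw [Finset.sum_const, smul_eq_mul, mul_one, Finset.card_eq_one]
    refine ⟨e', ?_⟩
    ext e
    simp only [Finset.mem_filter, Finset.mem_univ, true_and, Finset.mem_singleton, id]
    exact ⟨fun h => h.1, fun h => ⟨h, h ▸ hv⟩⟩
  · rw [Finset.sum_const, smul_eq_mul, mul_one, Finset.card_eq_one]
    exact ⟨v', by ext v; simp⟩

end EdgeWeightedGraph

/-! ### Conclusion -/

namespace EdgeWeightedGraph

/-- Only pairs involving infinity are new. The finite points of the target already have finite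
preimages, so points at infinity go to points at infinity, which are infinitely far from all other
points. -/
theorem IsExpansive.dist_eq {G₁ G₂ : EdgeWeightedGraph} {φ : G₁.Point → G₂.Point}
    (h : IsExpansive 1 φ) (x y : G₁.Point) : G₂.dist (φ x) (φ y) = G₁.dist x y := by
  obtain ⟨-, hbij, hfin, hdist⟩ := h
  have hinf : ∀ {x}, x ∈ G₁.infinitePoints → φ x ∈ G₂.infinitePoints := by
    intro x hx
    by_contra hφx
    obtain ⟨y, hy, hyx⟩ := hfin.surjOn hφx
    exact hbij.1 hyx ▸ hy <| hx
  rcases eq_or_ne x y with rfl | hxy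
  · rw [dist_self, dist_self]
  by_cases hy : y ∈ G₁.finitePoints
  · by_cases hx : x ∈ G₁.finitePoints
    · rw [hdist x hx y hy, ENNReal.ofReal_one, one_mul]
    · rw [dist_comm, dist_comm x, dist_of_mem_infinitePoints (not_not.1 hx) hxy.symm,
        dist_of_mem_infinitePoints (hinf (not_not.1 hx)) (hbij.1.ne hxy.symm)]
  · rw [dist_of_mem_infinitePoints (not_not.1 hy) hxy,
      dist_of_mem_infinitePoints (hinf (not_not.1 hy)) (hbij.1.ne hxy)]

end EdgeWeightedGraph

theorem theorem1 (G₁ G₂ : EdgeWeightedGraph) (ψ : G₁.Rat ≃+* G₂.Rat) :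
    ∃ r : ℝ, 0 < r ∧
      ψ (algebraMap TropicalReal G₁.Rat (TropicalReal.ofReal 1)) =
        algebraMap TropicalReal G₂.Rat (TropicalReal.ofReal r) ∧
      ∃ φ : G₁.Point → G₂.Point,
        (EdgeWeightedGraph.IsInducedBy ψ r φ ∧
          ∀ φ', EdgeWeightedGraph.IsInducedBy ψ r φ' → φ' = φ) ∧
        (∀ (f : G₁.Rat) (x : G₁.Point), (ψ f) (φ x) = (r : EReal) * f x) ∧
        EdgeWeightedGraph.IsExpansive r φ ∧
        ((∀ t : TropicalReal,
            ψ (algebraMap TropicalReal G₁.Rat t) = algebraMap TropicalReal G₂.Rat t) →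
          r = 1 ∧ EdgeWeightedGraph.IsFiniteHarmonicOfDegree φ 1) := by
  obtain ⟨r, hr, hψ⟩ := EdgeWeightedGraph.Rat.exists_map_ofReal ψ
  obtain ⟨φ, hφ⟩ := EdgeWeightedGraph.exists_homeomorph hr hψ
  have h1 := hψ 1
  rw [mul_one] at h1
  have hexp := EdgeWeightedGraph.isExpansive hr hφ
  refine ⟨r, hr, h1, φ, ⟨EdgeWeightedGraph.isInducedBy hr hψ (φ := φ.toEquiv) hφ,
    fun φ' h => h.eq hr hφ⟩, hφ, hexp, fun halg => ?_⟩
  -- Compatibility with the constant `1` alone forces `r = 1`.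
  obtain rfl : r = 1 :=
    EdgeWeightedGraph.Rat.ofReal_injective (h1.symm.trans (halg (TropicalReal.ofReal 1)))
  exact ⟨rfl, EdgeWeightedGraph.isFiniteHarmonicOfDegree_one φ hexp.dist_eq⟩
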